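/- Let $p$ be a prime, let $K$ be a finite extension of $\mathbb{Q}_p$, let $\overline K$ be an algebraic closure of $K$, and let $v$ be the $p$-adic valuation on $\overline K$ normalized by $v(p)=1$ (so $v(0)=\infty$). Let $a, c \in K$ with $c \neq 0$, and let $f(z) = z^p - c$. For $n \ge 0$ let $f^n$ be the $n$-th iterate of $f$, let $f^{-n}(a) \subset \overline K$ be the set of solutions of $f^n(z)=a$, let $K_n = K(f^{-n}(a))$, and let $K_\infty = \bigcup_n K_n$. Call $K_\infty/K$ finitely ramified if its ramification index $(v(K_\infty^\times) : v(K^\times))$ is finite, and infinitely ramified otherwise. (a) If $v(c) < -p/(p-1)$, then $K_\infty/K$ is a finite extension. (b) If $v(c) = -p/(p-1)$, then $K_\infty/K$ is an infinite extension; moreover $K_\infty/K$ is finitely ramified if and only if $v(a-b) \ge 0$ for some fixed point $b \in \overline K$ of $f$ (that is, $a$ lies in the closed unit disk centered at a fixed point of $f$), equivalently, if and only if $v(a-b) \ge 0$ for every fixed point $b \in \overline K$ of $f$. (c) If $v(c) > -p/(p-1)$, then $K_\infty/K$ is infinitely ramified. -/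

import Mathlib

open Polynomial

namespace LocalArboreal

/-! ### The valuation -/

section Valuation

variable (p : ℕ) [Fact p.Prime] {Ω : Type*} [Field Ω] [Algebra ℚ_[p] Ω]

open Classical in
/-- The function underlying `val`: `v 0 = ∞`, and `v x = -log_p |x|` for `x ≠ 0`, where `|·|` is
the unique extension to `Ω` of the `p`-adic absolute value of `ℚ_p` (so `|p| = 1/p`). -/
noncomputable def valFun (x : Ω) : WithTop ℝ :=
  if x = 0 then ⊤ else ((-Real.logb p (spectralNorm ℚ_[p] Ω x) : ℝ) : WithTop ℝ)

variable [Algebra.IsAlgebraic ℚ_[p] Ω]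

theorem spectralNorm_pos {x : Ω} (hx : x ≠ 0) : 0 < spectralNorm ℚ_[p] Ω x :=
  spectralNorm_zero_lt hx (Algebra.IsAlgebraic.isAlgebraic x)

theorem spectralNorm_mul_eq (x y : Ω) :
    spectralNorm ℚ_[p] Ω (x * y) = spectralNorm ℚ_[p] Ω x * spectralNorm ℚ_[p] Ω y :=
  map_mul (spectralMulAlgNorm ℚ_[p] Ω) x y

theorem valFun_add (x y : Ω) : min (valFun p x) (valFun p y) ≤ valFun p (x + y) := by
  by_cases hx : x = 0
  · subst hx; rw [zero_add]; exact min_le_right _ _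
  by_cases hy : y = 0
  · subst hy; rw [add_zero]; exact min_le_left _ _
  by_cases hxy : x + y = 0
  · simp [hxy, valFun]
  have hp : (1 : ℝ) < p := by exact_mod_cast (Fact.out : p.Prime).one_lt
  have h := isNonarchimedean_spectralNorm (K := ℚ_[p]) (L := Ω) x y
  simp only [valFun, hx, hy, hxy, if_false, min_le_iff, WithTop.coe_le_coe, neg_le_neg_iff]
  rcases le_max_iff.mp h with h | h
  · exact Or.inl (Real.logb_le_logb_of_le hp (spectralNorm_pos p hxy) h)
  · exact Or.inr (Real.logb_le_logb_of_le hp (spectralNorm_pos p hxy) h)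

theorem valFun_mul (x y : Ω) : valFun p (x * y) = valFun p x + valFun p y := by
  by_cases hx : x = 0
  · simp [hx, valFun]
  by_cases hy : y = 0
  · simp [hy, valFun]
  simp only [valFun, hx, hy, mul_eq_zero, or_self, if_false, spectralNorm_mul_eq,
    Real.logb_mul (spectralNorm_pos p hx).ne' (spectralNorm_pos p hy).ne', neg_add]
  rfl

/-- The `p`-adic valuation `v` on an algebraic extension `Ω` of `ℚ_p`, normalized by `v p = 1`. -/
noncomputable def val : AddValuation Ω (WithTop ℝ) :=
  AddValuation.of (valFun p) (by simp [valFun]) (by simp [valFun, spectralNorm_one])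
    (valFun_add p) (valFun_mul p)

theorem val_prime : val p (p : Ω) = 1 := by
  have hp : (1 : ℝ) < p := by exact_mod_cast (Fact.out : p.Prime).one_lt
  have h0 : (p : ℚ_[p]) ≠ 0 := by exact_mod_cast (Fact.out : p.Prime).ne_zero
  have h1 : (p : Ω) = algebraMap ℚ_[p] Ω p := by simp
  have h2 : (p : Ω) ≠ 0 := by
    rw [h1]; exact (_root_.map_ne_zero _).mpr h0
  have h3 : spectralNorm ℚ_[p] Ω (p : Ω) = (p : ℝ)⁻¹ := by
    rw [h1, spectralNorm_extends, Padic.norm_p]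
  simp only [val, AddValuation.of_apply, valFun, h2, if_false, h3, Real.logb_inv, neg_neg]
  rw [Real.logb_self_eq_one hp]
  rfl

/-! ### Ramification -/

variable {K : Type*} [Field K] [Algebra K Ω]

/-- The value group `v(Lˣ) ⊆ ℝ` of an intermediate field `K ⊆ L ⊆ Ω`. -/
def valueGroup (L : IntermediateField K Ω) : AddSubgroup ℝ where
  carrier := {r | ∃ x ∈ L, val p x = (r : WithTop ℝ)}
  zero_mem' := ⟨1, L.one_mem, by simp⟩
  add_mem' := by
    rintro r s ⟨x, hx, hr⟩ ⟨y, hy, hs⟩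
    exact ⟨x * y, L.mul_mem hx hy, by rw [AddValuation.map_mul, hr, hs]; rfl⟩
  neg_mem' := by
    rintro r ⟨x, hx, hr⟩
    have hx0 : x ≠ 0 := by
      rintro rfl
      rw [AddValuation.map_zero] at hr
      exact WithTop.top_ne_coe hr
    refine ⟨x⁻¹, L.inv_mem hx, ?_⟩
    have h : val p x⁻¹ + val p x = 0 := by
      rw [← AddValuation.map_mul, inv_mul_cancel₀ hx0, AddValuation.map_one]
    rw [hr] at h
    have ht : val p x⁻¹ ≠ ⊤ := by
      intro h'
      rw [h'] at h
      simp at h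
    obtain ⟨t, ht⟩ := WithTop.ne_top_iff_exists.mp ht
    rw [← ht] at h ⊢
    have h' : t + r = 0 := by exact_mod_cast h
    rw [eq_neg_of_add_eq_zero_left h']

/-- `L/K` is finitely ramified: its ramification index `(v(Lˣ) : v(Kˣ))` is finite. -/
def FinitelyRamified (L : IntermediateField K Ω) : Prop :=
  ((valueGroup p (⊥ : IntermediateField K Ω)).addSubgroupOf (valueGroup p L)).FiniteIndex

end Valuation

/-! ### The arboreal extension -/

section Arboreal

variable {K : Type*} [Field K] (Ω : Type*) [Field Ω] [Algebra K Ω]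

/-- The set `f^{-n}(a)` of solutions in `Ω` to `f^n(z) = a`, with `f^n` the `n`th iterate. -/
def iteratedPreimage (f : K[X]) (a : K) (n : ℕ) : Set Ω :=
  {z | (fun w : Ω => aeval w f)^[n] z = algebraMap K Ω a}

/-- `K_n = K(f^{-n}(a))`. -/
def arborealField (f : K[X]) (a : K) (n : ℕ) : IntermediateField K Ω :=
  IntermediateField.adjoin K (iteratedPreimage Ω f a n)

/-- `K_∞`, the union of the increasing sequence of the fields `K_n`. -/
def arborealFieldInfty (f : K[X]) (a : K) : IntermediateField K Ω :=
  ⨆ n : ℕ, arborealField Ω f a n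

end Arboreal

end LocalArboreal

/-!
Write `‖·‖` for the spectral norm on `Ω`, let `ζ` be a primitive `p`-th root of unity and
`q = ‖1 - ζ‖`, so that `q ^ (p - 1) = 1/p` and the comparison of `v(c)` with `-p/(p - 1)` becomes the
comparison of `‖c‖q ^ p` with `1` (`val_lt_iff`, `lt_val_iff`). If `1 < ‖c‖`, a fixed point `b` of
`f` satisfies `‖b‖ ^ p = ‖c‖`, so the threshold is `q‖b‖ = 1`.

Everything rests on the factorization `w ^ p - z ^ p = ∏ (w - ηz)` over the `p`-th roots of unity
`η`, where `‖z - ηz‖ = q‖z‖` for `η ≠ 1`. If `‖w ^ p - z ^ p‖` is not too small compared with `q‖z‖`,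
then `‖w - z‖` is the `p`-th root of it (`norm_sub_pow_of_le`); if it is small, some `ηz` is
closer to `w` than the other ones.

*Infinite ramification.* A field containing elements whose norms are successive `p`-th roots of a
number other than `0` and `1` is infinitely ramified (`not_normsInRootsOfPrime_of_pow_eq`). Such
elements are found as differences of preimages of `a`: if `q‖b‖ ≤ 1` and `1 < ‖a - b‖`, consecutive
points of a backward orbit (`not_normsInRootsOfPrime_of_one_lt_norm_sub`); if `‖c‖q ^ p < 1` and `a`
is close to `b`, two backward orbits that start at `z` and `ζz`
(`not_normsInRootsOfPrime_of_le_norm`). The latter fails only if `c` and all the preimages are very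
small, and then a single backward orbit does.

*The expanding case* `1 < q‖b‖`. Backward orbits enter the ball of radius `q‖b‖` around `b`
(`exists_level_norm_sub_le`), and for `w` in this ball each `p`-th root of `w + c` is closer to some
`ηb` than to its own conjugates. As in Krasner's lemma, it lies in every field that contains `w`,
`ζ` and `b` (`isometry_apply_eq_self`), so finitely many levels generate the whole extension.

*The critical case* `q‖b‖ = 1` with `‖a - b‖ ≤ 1`. The distinct preimages of a point are at mutual
distance `1`. Adjoining an integral element whose conjugates have this property creates no new
norms (`exists_norm_eq_of_mem_adjoin`), so the extension is unramified over `K(b)`. It is infinite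
because the `n`-th preimages contain `2 ^ n` points at pairwise distance at least `1`
(`exists_finset_separated`), while bounded subsets of a finite extension of `ℚ_p` are totally
bounded.
-/

namespace LocalArboreal

/-! ### Differences of `p`-th powers in an ultrametric field -/

section PowSub

open scoped Classical

variable {Ω : Type*} [NormedField Ω] [IsUltrametricDist Ω] {p : ℕ} [hpp : Fact p.Prime] {ζ : Ω}

omit [IsUltrametricDist Ω] in
theorem norm_eq_one_of_pow_eq_one {η : Ω} (h : η ^ p = 1) : ‖η‖ = 1 := by
  have h1 : ‖η‖ ^ p = 1 := by rw [← norm_pow, h, norm_one]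
  exact (pow_eq_one_iff_of_nonneg (norm_nonneg _) hpp.out.ne_zero).1 h1

theorem norm_one_sub_pow_le {η : Ω} (h : ‖η‖ = 1) (k : ℕ) : ‖1 - η ^ k‖ ≤ ‖1 - η‖ := by
  rw [← mul_neg_geom_sum η k, norm_mul]
  refine mul_le_of_le_one_right (norm_nonneg _) ?_
  refine IsUltrametricDist.norm_sum_le_of_forall_le_of_nonneg zero_le_one fun i _ => ?_
  rw [norm_pow, h, one_pow]

/-- All nontrivial `p`-th roots of unity are at the same distance from `1`. -/
theorem norm_one_sub_eq (hζ : IsPrimitiveRoot ζ p) {η : Ω} (hη : η ^ p = 1) (h1 : η ≠ 1) :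
    ‖1 - η‖ = ‖1 - ζ‖ := by
  have hη' : IsPrimitiveRoot η p := by
    have := IsPrimitiveRoot.orderOf η
    rwa [orderOf_eq_prime hη h1] at this
  obtain ⟨i, -, hi⟩ := hζ.eq_pow_of_pow_eq_one hη
  obtain ⟨j, -, hj⟩ := hη'.eq_pow_of_pow_eq_one hζ.pow_eq_one
  apply le_antisymm
  · rw [← hi]; exact norm_one_sub_pow_le (norm_eq_one_of_pow_eq_one hζ.pow_eq_one) i
  · rw [← hj]; exact norm_one_sub_pow_le (norm_eq_one_of_pow_eq_one hη) j

theorem norm_one_sub_pow_pred (hζ : IsPrimitiveRoot ζ p) :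
    ‖1 - ζ‖ ^ (p - 1) = ‖(p : Ω)‖ := by
  have h := congrArg (eval (1 : Ω)) (cyclotomic_eq_prod_X_sub_primitiveRoots hζ)
  rw [eval_one_cyclotomic_prime, eval_prod] at h
  rw [h, norm_prod]
  rw [Finset.prod_congr rfl (g := fun _ => ‖1 - ζ‖), Finset.prod_const, hζ.card_primitiveRoots,
    Nat.totient_prime hpp.out]
  intro η hη
  have hη' := (mem_primitiveRoots hpp.out.pos).1 hη
  rw [eval_sub, eval_X, eval_C]
  exact norm_one_sub_eq hζ hη'.pow_eq_one (hη'.ne_one hpp.out.one_lt)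

omit [IsUltrametricDist Ω] in
theorem norm_one_sub_pos (hζ : IsPrimitiveRoot ζ p) : 0 < ‖1 - ζ‖ :=
  norm_pos_iff.2 (sub_ne_zero.2 (hζ.ne_one hpp.out.one_lt).symm)

theorem norm_one_sub_lt_one (hζ : IsPrimitiveRoot ζ p) (hp : ‖(p : Ω)‖ = (p : ℝ)⁻¹) :
    ‖1 - ζ‖ < 1 := by
  have h := norm_one_sub_pow_pred hζ
  by_contra! h'
  have h2 : (1 : ℝ) ≤ (p : ℝ)⁻¹ := hp ▸ h ▸ one_le_pow₀ h'
  have h3 : (1 : ℝ) < p := by exact_mod_cast hpp.out.one_lt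
  exact absurd (inv_lt_one_of_one_lt₀ h3) (not_lt.2 h2)

omit [IsUltrametricDist Ω] in
theorem norm_pow_sub_pow_eq_prod (hζ : IsPrimitiveRoot ζ p) (w z : Ω) :
    ‖w ^ p - z ^ p‖ = ‖w - z‖ * ∏ η ∈ (nthRootsFinset p (1 : Ω)).erase 1, ‖w - η * z‖ := by
  have h1 : (1 : Ω) ∈ nthRootsFinset p (1 : Ω) := by simp [mem_nthRootsFinset hpp.out.pos]
  rw [hζ.pow_sub_pow_eq_prod_sub_mul w z hpp.out.pos, norm_prod, ← Finset.mul_prod_erase _ _ h1,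
    one_mul]

omit [IsUltrametricDist Ω] in
theorem card_erase_nthRootsFinset (hζ : IsPrimitiveRoot ζ p) :
    ((nthRootsFinset p (1 : Ω)).erase 1).card = p - 1 := by
  rw [Finset.card_erase_of_mem (by simp [mem_nthRootsFinset hpp.out.pos]), hζ.card_nthRootsFinset]

theorem norm_sub_root_mul (hζ : IsPrimitiveRoot ζ p) (z : Ω) {η : Ω}
    (hη : η ∈ (nthRootsFinset p (1 : Ω)).erase 1) : ‖z - η * z‖ = ‖1 - ζ‖ * ‖z‖ := by
  rw [Finset.mem_erase, mem_nthRootsFinset hpp.out.pos] at hη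
  rw [← one_sub_mul, norm_mul, norm_one_sub_eq hζ hη.2 hη.1]

/-- If `w` is farther from `z` than the other `p`-th roots `ηz` are, all factors of
`w ^ p - z ^ p = ∏ (w - ηz)` have the same norm. -/
theorem norm_pow_sub_pow_of_lt (hζ : IsPrimitiveRoot ζ p) {w z : Ω}
    (h : ‖1 - ζ‖ * ‖z‖ < ‖w - z‖) : ‖w ^ p - z ^ p‖ = ‖w - z‖ ^ p := by
  rw [norm_pow_sub_pow_eq_prod hζ, Finset.prod_congr rfl (g := fun _ => ‖w - z‖),
    Finset.prod_const, card_erase_nthRootsFinset hζ, ← pow_succ',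
    Nat.sub_add_cancel hpp.out.one_le]
  intro η hη
  have h2 := norm_sub_root_mul hζ z hη
  rw [← sub_add_sub_cancel w z, IsUltrametricDist.norm_add_eq_max_of_norm_ne_norm (by
    rw [h2]; exact h.ne'), h2, max_eq_left h.le]

/-- If `w` is no farther from `z` than the other `p`-th roots `ηz` are, every other factor of
`w ^ p - z ^ p = ∏ (w - ηz)` has norm at most `q‖z‖`. -/
theorem norm_pow_sub_pow_le (hζ : IsPrimitiveRoot ζ p) {w z : Ω}
    (h : ‖w - z‖ ≤ ‖1 - ζ‖ * ‖z‖) :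
    ‖w ^ p - z ^ p‖ ≤ ‖w - z‖ * (‖1 - ζ‖ * ‖z‖) ^ (p - 1) := by
  rw [norm_pow_sub_pow_eq_prod hζ, ← card_erase_nthRootsFinset hζ]
  refine mul_le_mul_of_nonneg_left ?_ (norm_nonneg _)
  rw [← Finset.prod_const]
  refine Finset.prod_le_prod (fun _ _ => norm_nonneg _) fun η hη => ?_
  have h2 := norm_sub_root_mul hζ z hη
  rw [← sub_add_sub_cancel w z]
  exact (IsUltrametricDist.norm_add_le_max _ _).trans (max_le h h2.le)

/-- The Newton polygon of `t ↦ (z + t) ^ p - z ^ p` in its inseparable range: if the `p`-th powers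
are far apart, compared with the distance `q‖z‖` between distinct `p`-th roots, then passing to
`p`-th roots extracts the `p`-th root of the distance. -/
theorem norm_sub_pow_of_le (hζ : IsPrimitiveRoot ζ p) {w z : Ω} {l : ℝ} (hl : 0 < l)
    (hz : ‖1 - ζ‖ * ‖z‖ ≤ l) (h : l ^ p ≤ ‖w ^ p - z ^ p‖) :
    ‖w - z‖ ^ p = ‖w ^ p - z ^ p‖ := by
  rcases lt_or_ge (‖1 - ζ‖ * ‖z‖) ‖w - z‖ with h1 | h1
  · exact (norm_pow_sub_pow_of_lt hζ h1).symm
  have h0 : 0 ≤ ‖1 - ζ‖ * ‖z‖ := by positivity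
  have h2 := norm_pow_sub_pow_le hζ h1
  have hp : l ^ p = l * l ^ (p - 1) := by
    rw [← pow_succ', Nat.sub_add_cancel hpp.out.one_le]
  have h3 : ‖w - z‖ * (‖1 - ζ‖ * ‖z‖) ^ (p - 1) ≤ ‖w - z‖ * l ^ (p - 1) := by gcongr
  have h4 : l ≤ ‖w - z‖ := by
    have : l * l ^ (p - 1) ≤ ‖w - z‖ * l ^ (p - 1) := hp ▸ h.trans (h2.trans h3)
    exact le_of_mul_le_mul_right this (by positivity)
  have h5 : ‖w - z‖ = l := le_antisymm (h1.trans hz) h4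
  rw [h5] at h3 h2 ⊢
  rw [hp] at h ⊢
  exact le_antisymm h (h2.trans h3)

theorem norm_sub_le_one_of_pow_sub (hζ : IsPrimitiveRoot ζ p) {w z : Ω}
    (hz : ‖1 - ζ‖ * ‖z‖ ≤ 1) (h : ‖w ^ p - z ^ p‖ ≤ 1) : ‖w - z‖ ≤ 1 := by
  by_contra! h1
  rw [norm_pow_sub_pow_of_lt hζ (hz.trans_lt h1)] at h
  exact absurd (one_lt_pow₀ h1 hpp.out.ne_zero) (not_lt.2 h)

end PowSub

/-! ### Backward orbits of `w ↦ w ^ p - c` -/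

section Dynamics

variable {Ω : Type*} [NormedField Ω] [IsUltrametricDist Ω] {p : ℕ} [hpp : Fact p.Prime] {ζ : Ω}
  {a b c : Ω}

/-- The `M`-th powers of the norms of the nonzero elements of `L` are integral powers of `p`. In
additive terms, the value group of `L` lies in `(1/M)ℤ`. -/
def NormsInRootsOfPrime (p M : ℕ) (L : Subfield Ω) : Prop :=
  ∀ x ∈ L, x ≠ 0 → ∃ k : ℤ, ‖x‖ ^ M = (p : ℝ) ^ k

omit [IsUltrametricDist Ω] in
/-- Successive `p`-th roots of a norm other than `0` and `1` need unbounded denominators. -/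
theorem not_normsInRootsOfPrime_of_pow_eq {M : ℕ} (hM : 0 < M) {L : Subfield Ω} {x : ℕ → Ω}
    (hx : ∀ n, x n ∈ L) (h : ∀ n, ‖x (n + 1)‖ ^ p = ‖x n‖) (h0 : x 0 ≠ 0) (h1 : ‖x 0‖ ≠ 1) :
    ¬ NormsInRootsOfPrime p M L := by
  intro hL
  have hp1 : (1 : ℝ) < p := by exact_mod_cast hpp.out.one_lt
  have hne : ∀ n, x n ≠ 0 := by
    intro n
    induction n with
    | zero => exact h0
    | succ n ih =>
      intro h2
      have := h n
      rw [h2, norm_zero, zero_pow hpp.out.ne_zero] at this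
      exact ih (norm_eq_zero.1 this.symm)
  choose k hk using fun n => hL (x n) (hx n) (hne n)
  have hk1 : ∀ n, k n = p * k (n + 1) := by
    intro n
    apply zpow_right_injective₀ (by positivity) hp1.ne'
    change (p : ℝ) ^ k n = (p : ℝ) ^ ((p : ℤ) * k (n + 1))
    rw [← hk n, ← h n, mul_comm, zpow_mul, ← hk (n + 1), zpow_natCast, ← pow_mul, ← pow_mul,
      mul_comm]
  have hk2 : ∀ n, k 0 = p ^ n * k n := by
    intro n
    induction n with
    | zero => simp
    | succ n ih => rw [ih, hk1 n, pow_succ, mul_assoc]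
  have hk0 : k 0 = 0 := by
    by_contra hne0
    refine absurd (Int.le_of_dvd (abs_pos.2 hne0) ((dvd_abs _ _).2 ⟨_, hk2 (k 0).natAbs⟩)) ?_
    rw [not_le, Int.abs_eq_natAbs]
    exact_mod_cast Nat.lt_pow_self hpp.out.one_lt
  have := hk 0
  rw [hk0, zpow_zero] at this
  exact h1 ((pow_eq_one_iff_of_nonneg (norm_nonneg _) hM.ne').1 this)

omit [IsUltrametricDist Ω] hpp in
theorem iterate_add_of_pow_eq {k : ℕ} {x : ℕ → Ω}
    (hx : ∀ n, x (n + 1) ^ p = x n + c) (h0 : (fun w : Ω => w ^ p - c)^[k] (x 0) = a) (n : ℕ) :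
    (fun w : Ω => w ^ p - c)^[k + n] (x n) = a := by
  induction n with
  | zero => exact h0
  | succ n ih =>
    rw [← add_assoc, Function.iterate_succ_apply]
    simpa [hx n] using ih

omit [IsUltrametricDist Ω] in
theorem exists_backward_orbit [IsAlgClosed Ω] (c z : Ω) :
    ∃ x : ℕ → Ω, x 0 = z ∧ ∀ n, x (n + 1) ^ p = x n + c := by
  choose r hr using fun w : Ω => IsAlgClosed.exists_pow_nat_eq (w + c) hpp.out.pos
  refine ⟨fun n => r^[n] z, rfl, fun n => ?_⟩
  simp only [Function.iterate_succ_apply']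
  exact hr _

omit [IsUltrametricDist Ω] in
theorem exists_fixedPoint [IsAlgClosed Ω] (c : Ω) : ∃ b : Ω, b ^ p = b + c := by
  have hd : (X ^ p - (X + C c) : Polynomial Ω).degree = (p : ℕ) := by
    rw [degree_sub_eq_left_of_degree_lt, degree_X_pow]
    rw [degree_X_pow, degree_X_add_C]
    exact_mod_cast hpp.out.one_lt
  obtain ⟨b, hb⟩ := IsAlgClosed.exists_root (X ^ p - (X + C c) : Polynomial Ω) (by
    rw [hd]; exact_mod_cast hpp.out.ne_zero)
  refine ⟨b, sub_eq_zero.1 ?_⟩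
  simpa using hb

omit hpp in
theorem norm_pow_eq_of_pow_eq {w z : Ω} (h : z ^ p = w + c) (hw : ‖w‖ < ‖c‖) :
    ‖z‖ ^ p = ‖c‖ := by
  rw [← norm_pow, h, IsUltrametricDist.norm_add_eq_max_of_norm_ne_norm hw.ne, max_eq_right hw.le]

theorem norm_fixedPoint_pow (hb : b ^ p = b + c) (hc : 1 < ‖c‖) : ‖b‖ ^ p = ‖c‖ := by
  rcases lt_or_ge ‖b‖ ‖c‖ with h | h
  · exact norm_pow_eq_of_pow_eq hb h
  have h1 : ‖b‖ ^ p ≤ ‖b‖ := by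
    rw [← norm_pow, hb]
    exact (IsUltrametricDist.norm_add_le_max _ _).trans (max_le le_rfl h)
  exact absurd (lt_self_pow₀ (hc.trans_le h) hpp.out.one_lt) (not_lt.2 h1)

theorem norm_fixedPoint_le_one (hb : b ^ p = b + c) (hc : ‖c‖ ≤ 1) : ‖b‖ ≤ 1 := by
  by_contra! h1
  have h2 : ‖b‖ ^ p ≤ ‖b‖ := by
    rw [← norm_pow, hb]
    exact (IsUltrametricDist.norm_add_le_max _ _).trans (max_le le_rfl (hc.trans h1.le))
  exact absurd (lt_self_pow₀ h1 hpp.out.one_lt) (not_lt.2 h2)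

/-- Once two backward orbits are far enough apart, each step backwards extracts a `p`-th root of
their distance. -/
theorem norm_sub_pow_of_backward_orbits (hζ : IsPrimitiveRoot ζ p) {x y : ℕ → Ω} {l : ℝ}
    (hx : ∀ n, x (n + 1) ^ p = x n + c) (hy : ∀ n, y (n + 1) ^ p = y n + c)
    (hl : 0 < l) (hl1 : l ≤ 1) (hyl : ∀ n, ‖1 - ζ‖ * ‖y (n + 1)‖ ≤ l)
    (h0 : l ^ p ≤ ‖x 0 - y 0‖) (n : ℕ) :
    ‖x (n + 1) - y (n + 1)‖ ^ p = ‖x n - y n‖ := by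
  have step : ∀ n, l ^ p ≤ ‖x n - y n‖ → ‖x (n + 1) - y (n + 1)‖ ^ p = ‖x n - y n‖ := by
    intro n hn
    have h1 : x (n + 1) ^ p - y (n + 1) ^ p = x n - y n := by rw [hx, hy]; ring
    rw [← h1] at hn ⊢
    exact norm_sub_pow_of_le hζ hl (hyl n) hn
  have bound : ∀ n, l ^ p ≤ ‖x n - y n‖ := by
    intro n
    induction n with
    | zero => exact h0
    | succ n ih =>
      rw [← step n ih] at ih
      exact (pow_le_of_le_one hl.le hl1 hpp.out.ne_zero).trans
        (le_of_pow_le_pow_left₀ hpp.out.ne_zero (norm_nonneg _) ih)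
  exact step n (bound n)

/-- A point far from a fixed point whose multiplier is not too expanding: the distances
`‖zₙ - zₙ₊₁‖ = ‖zₙ - b‖` along a backward orbit are successive `p`-th roots of `‖a - b‖`. -/
theorem not_normsInRootsOfPrime_of_one_lt_norm_sub [IsAlgClosed Ω] (hζ : IsPrimitiveRoot ζ p)
    (hb : b ^ p = b + c) (hqb : ‖1 - ζ‖ * ‖b‖ ≤ 1) (ha : 1 < ‖a - b‖) {M : ℕ} (hM : 0 < M)
    {L : Subfield Ω} (hL : ∀ n z, (fun w : Ω => w ^ p - c)^[n] z = a → z ∈ L) :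
    ¬ NormsInRootsOfPrime p M L := by
  obtain ⟨x, hx0, hx⟩ := exists_backward_orbit (p := p) c a
  have hmem : ∀ n, x n ∈ L := fun n =>
    hL (0 + n) _ (iterate_add_of_pow_eq hx (by simpa using hx0) n)
  have hpow := norm_sub_pow_of_backward_orbits (y := fun _ => b) hζ hx (fun _ => hb) one_pos le_rfl
    (fun _ => hqb) (by rw [one_pow, hx0]; exact ha.le)
  have hgt : ∀ n, 1 < ‖x n - b‖ := by
    intro n
    induction n with
    | zero => rwa [hx0]
    | succ n ih =>
      by_contra! h
      rw [← hpow n] at ih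
      exact absurd (pow_le_one₀ (norm_nonneg _) h) (not_le.2 ih)
  have hd : ∀ n, ‖x n - x (n + 1)‖ = ‖x n - b‖ := by
    intro n
    have h1 : ‖x (n + 1) - b‖ < ‖x n - b‖ := by
      rw [← hpow n]; exact lt_self_pow₀ (hgt _) hpp.out.one_lt
    have h2 : x n - x (n + 1) = (x n - b) + -(x (n + 1) - b) := by ring
    rw [h2, IsUltrametricDist.norm_add_eq_max_of_norm_ne_norm (by rw [norm_neg]; exact h1.ne'),
      norm_neg, max_eq_left h1.le]
  refine not_normsInRootsOfPrime_of_pow_eq hM (x := fun n => x n - x (n + 1))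
    (fun n => L.sub_mem (hmem n) (hmem (n + 1))) (fun n => ?_) ?_ ?_
  · rw [hd, hd, hpow]
  · exact norm_pos_iff.1 (by rw [hd]; exact one_pos.trans (hgt 0))
  · rw [hd]; exact (hgt 0).ne'

/-- The unit ball around a fixed point `b` with `q‖b‖ ≤ 1` contains the full preimage of itself. -/
theorem norm_sub_fixedPoint_le_one (hζ : IsPrimitiveRoot ζ p)
    (hb : b ^ p = b + c) (hqb : ‖1 - ζ‖ * ‖b‖ ≤ 1) (ha : ‖a - b‖ ≤ 1) {n : ℕ} {z : Ω}
    (hz : (fun w : Ω => w ^ p - c)^[n] z = a) : ‖z - b‖ ≤ 1 := by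
  induction n generalizing z with
  | zero => rwa [← hz] at ha
  | succ n ih =>
    have h := ih (z := z ^ p - c) hz
    have h1 : z ^ p - b ^ p = z ^ p - c - b := by rw [hb]; ring
    exact norm_sub_le_one_of_pow_sub hζ hqb (h1 ▸ h)

theorem norm_eq_of_norm_sub_lt {x y : Ω} (h : ‖x - y‖ < ‖y‖) : ‖x‖ = ‖y‖ := by
  rw [← sub_add_cancel x y, IsUltrametricDist.norm_add_eq_max_of_norm_ne_norm h.ne,
    max_eq_right h.le]

/-- Two points `z`, `ζz` of the same level start two backward orbits whose distances are
successive `p`-th roots of `q‖z‖`. -/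
theorem not_normsInRootsOfPrime_of_le_norm [IsAlgClosed Ω] (hζ : IsPrimitiveRoot ζ p) {l : ℝ}
    (hl : 0 < l) (hl1 : l < 1)
    (hT : ∀ n z, (fun w : Ω => w ^ p - c)^[n] z = a → ‖1 - ζ‖ * ‖z‖ ≤ l)
    {k : ℕ} {z : Ω} (hz : (fun w : Ω => w ^ p - c)^[k + 1] z = a) (hzl : l ^ p ≤ ‖1 - ζ‖ * ‖z‖)
    {M : ℕ} (hM : 0 < M) {L : Subfield Ω}
    (hL : ∀ n z, (fun w : Ω => w ^ p - c)^[n] z = a → z ∈ L) :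
    ¬ NormsInRootsOfPrime p M L := by
  have hz' : (fun w : Ω => w ^ p - c)^[k + 1] (ζ * z) = a := by
    rw [Function.iterate_succ_apply] at hz ⊢
    rwa [mul_pow, hζ.pow_eq_one, one_mul]
  obtain ⟨x, hx0, hx⟩ := exists_backward_orbit (p := p) c z
  obtain ⟨y, hy0, hy⟩ := exists_backward_orbit (p := p) c (ζ * z)
  have hxT := iterate_add_of_pow_eq (c := c) hx (hx0 ▸ hz)
  have hyT := iterate_add_of_pow_eq (c := c) hy (hy0 ▸ hz')
  have hd : ‖x 0 - y 0‖ = ‖1 - ζ‖ * ‖z‖ := by rw [hx0, hy0, ← one_sub_mul, norm_mul]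
  have hpos : 0 < ‖x 0 - y 0‖ := hd ▸ (by positivity : 0 < l ^ p).trans_le hzl
  refine not_normsInRootsOfPrime_of_pow_eq hM (x := fun n => x n - y n)
    (fun n => L.sub_mem (hL _ _ (hxT n)) (hL _ _ (hyT n)))
    (norm_sub_pow_of_backward_orbits hζ hx hy hl hl1.le (fun n => hT _ _ (hyT (n + 1)))
      (hd ▸ hzl)) (norm_pos_iff.1 hpos) ?_
  rw [hd]
  exact ((hT _ _ hz).trans_lt hl1).ne

end Dynamics

/-! ### The three ranges of `‖c‖` -/

section Regimes

variable {Ω : Type*} [NormedField Ω] [IsUltrametricDist Ω] {p : ℕ} [hpp : Fact p.Prime] {ζ : Ω}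
  {a b c : Ω}

/-- The case `1 < ‖c‖ < q ^ (-p)`: if `a` is close to a fixed point `b`, then all its preimages have
norm `‖b‖`, and the pair `z`, `ζz` of first preimages is at distance `q‖b‖ < 1`. -/
theorem not_normsInRootsOfPrime_of_one_lt [IsAlgClosed Ω] (hζ : IsPrimitiveRoot ζ p)
    (hc1 : 1 < ‖c‖) (hc : ‖c‖ * ‖1 - ζ‖ ^ p < 1) {M : ℕ} (hM : 0 < M) {L : Subfield Ω}
    (hL : ∀ n z, (fun w : Ω => w ^ p - c)^[n] z = a → z ∈ L) :
    ¬ NormsInRootsOfPrime p M L := by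
  obtain ⟨b, hb⟩ := exists_fixedPoint (p := p) c
  have hbc := norm_fixedPoint_pow hb hc1
  have hb1 : 1 < ‖b‖ := by
    by_contra! h
    exact absurd (pow_le_one₀ (norm_nonneg _) h) (not_le.2 (hbc ▸ hc1))
  have hqb : ‖1 - ζ‖ * ‖b‖ < 1 := by
    by_contra! h
    have := one_le_pow₀ (n := p) h
    rw [mul_pow, hbc, mul_comm] at this
    exact absurd hc (not_lt.2 this)
  rcases lt_or_ge 1 ‖a - b‖ with ha | ha
  · exact not_normsInRootsOfPrime_of_one_lt_norm_sub hζ hb hqb.le ha hM hL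
  have hT : ∀ n z, (fun w : Ω => w ^ p - c)^[n] z = a → ‖z‖ = ‖b‖ := fun n z hz =>
    norm_eq_of_norm_sub_lt ((norm_sub_fixedPoint_le_one hζ hb hqb.le ha hz).trans_lt hb1)
  obtain ⟨x, hx0, hx⟩ := exists_backward_orbit (p := p) c a
  have hx1 := iterate_add_of_pow_eq (k := 0) hx (by simpa using hx0) 1
  rw [zero_add, ← zero_add 1] at hx1
  have hl : 0 < ‖1 - ζ‖ * ‖b‖ := mul_pos (norm_one_sub_pos hζ) (one_pos.trans hb1)
  refine not_normsInRootsOfPrime_of_le_norm hζ hl hqb (fun n z hz => by rw [hT n z hz]) hx1 ?_ hM hL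
  rw [hT _ _ hx1]
  exact pow_le_of_le_one hl.le hqb.le hpp.out.ne_zero

/-- The case of integral `c`: if `a` is integral, so are all its preimages. Either some preimage `z`
is large enough for the pair `z`, `ζz` to separate, or all preimages are so small that a backward
orbit can be chosen whose norms exceed `‖c‖` and hence are successive `p`-th roots. -/
theorem not_normsInRootsOfPrime_of_le_one [IsAlgClosed Ω] (hζ : IsPrimitiveRoot ζ p)
    (hp : ‖(p : Ω)‖ = (p : ℝ)⁻¹) (hc0 : c ≠ 0)
    (hc1 : ‖c‖ ≤ 1) {M : ℕ} (hM : 0 < M) {L : Subfield Ω}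
    (hL : ∀ n z, (fun w : Ω => w ^ p - c)^[n] z = a → z ∈ L) :
    ¬ NormsInRootsOfPrime p M L := by
  have hq0 := norm_one_sub_pos hζ
  have hq1 := norm_one_sub_lt_one hζ hp
  have hqp := (norm_one_sub_pow_pred hζ).trans hp
  have hp1 : (1 : ℝ) < p := by exact_mod_cast hpp.out.one_lt
  have hpi : (p : ℝ)⁻¹ < 1 := inv_lt_one_of_one_lt₀ hp1
  have hpp1 : p - 1 ≠ 0 := (Nat.sub_pos_of_lt hpp.out.one_lt).ne'
  obtain ⟨b, hb⟩ := exists_fixedPoint (p := p) c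
  have hb1 := norm_fixedPoint_le_one hb hc1
  rcases lt_or_ge 1 ‖a - b‖ with ha | ha
  · exact not_normsInRootsOfPrime_of_one_lt_norm_sub hζ hb (mul_le_one₀ hq1.le (norm_nonneg _) hb1)
      ha hM hL
  have hT : ∀ n z, (fun w : Ω => w ^ p - c)^[n] z = a → ‖z‖ ≤ 1 := by
    intro n z hz
    have := norm_sub_fixedPoint_le_one hζ hb (mul_le_one₀ hq1.le (norm_nonneg _) hb1) ha hz
    rw [← sub_add_cancel z b]
    exact (IsUltrametricDist.norm_add_le_max _ _).trans (max_le this hb1)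
  by_cases hbig : ∃ k z, (fun w : Ω => w ^ p - c)^[k + 1] z = a ∧ (p : ℝ)⁻¹ ≤ ‖z‖
  · obtain ⟨k, z, hz, hzp⟩ := hbig
    refine not_normsInRootsOfPrime_of_le_norm hζ hq0 hq1
      (fun n z hz => mul_le_of_le_one_right hq0.le (hT n z hz)) hz ?_ hM hL
    rw [← Nat.sub_add_cancel hpp.out.one_le, pow_succ', hqp]
    gcongr
  push Not at hbig
  -- All preimages are now close to `0`, so that `c` is small; of the two points `z + c` and
  -- `ζz + c`, one is not too small, and its `p`-th root dominates `c`.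
  obtain ⟨x, hx0, hx⟩ := exists_backward_orbit (p := p) c a
  have hx1 := iterate_add_of_pow_eq (k := 0) hx (by simpa using hx0) 1
  rw [zero_add, ← zero_add 1] at hx1
  have hsmall : ∀ z, (fun w : Ω => w ^ p - c)^[0 + 1] z = a → ‖z + c‖ < (p : ℝ)⁻¹ := by
    intro z hz
    obtain ⟨w, hw⟩ := IsAlgClosed.exists_pow_nat_eq (z + c) hpp.out.pos
    have hw1 : ‖w‖ < (p : ℝ)⁻¹ := hbig 1 w (by
      rw [Function.iterate_succ_apply, hw, add_sub_cancel_right]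
      exact hz)
    rw [← hw, norm_pow]
    exact (pow_le_of_le_one (norm_nonneg _) (hw1.le.trans hpi.le) hpp.out.ne_zero).trans_lt hw1
  have hcp : ‖c‖ < (p : ℝ)⁻¹ := by
    have h1 : c = (x 1 + c) + -x 1 := by ring
    rw [h1]
    refine (IsUltrametricDist.norm_add_le_max _ _).trans_lt (max_lt (hsmall _ hx1) ?_)
    rw [norm_neg]
    exact hbig 0 _ hx1
  have hqc : ‖c‖ ^ p < ‖1 - ζ‖ * ‖c‖ := by
    have h1 : (p : ℝ)⁻¹ ≤ ‖1 - ζ‖ := hqp ▸ pow_le_of_le_one hq0.le hq1.le hpp1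
    have hc0' := norm_pos_iff.2 hc0
    calc ‖c‖ ^ p = ‖c‖ ^ (p - 1) * ‖c‖ := by
          rw [← pow_succ, Nat.sub_add_cancel hpp.out.one_le]
      _ ≤ ‖c‖ * ‖c‖ := by
          gcongr
          exact pow_le_of_le_one hc0'.le hc1 hpp1
      _ < ‖1 - ζ‖ * ‖c‖ := by
          gcongr
          exact hcp.trans_le h1
  obtain ⟨y, hy, hyc⟩ : ∃ y, (fun w : Ω => w ^ p - c)^[0 + 1] y = a ∧ ‖c‖ ^ p < ‖y + c‖ := by
    by_contra! h
    have hx1' : (fun w : Ω => w ^ p - c)^[0 + 1] (ζ * x 1) = a := by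
      rw [Function.iterate_succ_apply] at hx1 ⊢
      rwa [mul_pow, hζ.pow_eq_one, one_mul]
    have h1 : (1 - ζ) * c = (ζ * x 1 + c) + -(ζ * (x 1 + c)) := by ring
    refine absurd hqc (not_lt.2 ?_)
    rw [← norm_mul, h1]
    refine (IsUltrametricDist.norm_add_le_max _ _).trans (max_le (h _ hx1') ?_)
    rw [norm_neg, norm_mul, norm_eq_one_of_pow_eq_one hζ.pow_eq_one, one_mul]
    exact h _ hx1
  obtain ⟨u, hu0, hu⟩ := exists_backward_orbit (p := p) c y
  have huT := iterate_add_of_pow_eq (c := c) hu (hu0 ▸ hy)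
  have hult : ∀ n, ‖u (n + 1)‖ < 1 := fun n => (hbig _ _ (huT (n + 1))).trans hpi
  have huc : ∀ n, ‖c‖ < ‖u (n + 1)‖ := by
    intro n
    induction n with
    | zero =>
      rw [← hu0, ← hu 0, norm_pow] at hyc
      exact lt_of_pow_lt_pow_left₀ p (norm_nonneg _) hyc
    | succ n ih =>
      have h1 : ‖u (n + 1 + 1)‖ ^ p = ‖u (n + 1)‖ := by
        rw [← norm_pow, hu, IsUltrametricDist.norm_add_eq_max_of_norm_ne_norm ih.ne',
          max_eq_left ih.le]
      refine ih.trans_le ?_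
      rw [← h1]
      exact pow_le_of_le_one (norm_nonneg _) (hult _).le hpp.out.ne_zero
  refine not_normsInRootsOfPrime_of_pow_eq hM (x := fun n => u (n + 1))
    (fun n => hL _ _ (huT (n + 1))) (fun n => ?_)
    (norm_pos_iff.1 ((norm_nonneg _).trans_lt (huc 0))) (hult 0).ne
  rw [← norm_pow, hu, IsUltrametricDist.norm_add_eq_max_of_norm_ne_norm (huc n).ne',
    max_eq_left (huc n).le]

open scoped Classical in
/-- When the reduction of `f` around a fixed point is separable, the fibres of `f` are separated,
and the `n`-th preimages of `a` contain large families of points at pairwise distance at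
least `1`. -/
theorem exists_finset_separated [IsAlgClosed Ω] (hζ : IsPrimitiveRoot ζ p)
    (hT : ∀ n z, (fun w : Ω => w ^ p - c)^[n] z = a → ‖1 - ζ‖ * ‖z‖ = 1) (n : ℕ) :
    ∃ F : Finset Ω, F.card = 2 ^ n ∧ (∀ z ∈ F, (fun w : Ω => w ^ p - c)^[n] z = a) ∧
      ∀ z ∈ F, ∀ w ∈ F, z ≠ w → 1 ≤ ‖z - w‖ := by
  induction n with
  | zero => exact ⟨{a}, by simp, by simp, by simp⟩
  | succ n ih =>
    obtain ⟨F, hFc, hF, hsep⟩ := ih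
    choose r hr using fun w : Ω => IsAlgClosed.exists_pow_nat_eq (w + c) hpp.out.pos
    have hg : ∀ s : Bool, ∀ w, ((if s then ζ else 1) * r w) ^ p = w + c := by
      rintro (_ | _) w <;> simp [mul_pow, hζ.pow_eq_one, hr]
    set g : Bool × Ω → Ω := fun s => (if s.1 then ζ else 1) * r s.2 with hgdef
    have hgp : ∀ s, g s ^ p = s.2 + c := fun s => hg s.1 s.2
    have hgT : ∀ s ∈ (Finset.univ : Finset Bool) ×ˢ F,
        (fun w : Ω => w ^ p - c)^[n + 1] (g s) = a := by
      intro s hs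
      rw [Function.iterate_succ_apply, hgp, add_sub_cancel_right]
      exact hF _ (Finset.mem_product.1 hs).2
    -- Points over the same `w` differ by `(1 - ζ)z`, of norm `q‖z‖ = 1`; if points over distinct
    -- `w`, `w'` were at distance less than `1`, then so would be `w` and `w'`.
    have hgsep : ∀ s ∈ (Finset.univ : Finset Bool) ×ˢ F, ∀ t ∈ (Finset.univ : Finset Bool) ×ˢ F,
        s ≠ t → 1 ≤ ‖g s - g t‖ := by
      intro s hs t ht hst
      by_cases h2 : s.2 = t.2
      · have h1 : s.1 ≠ t.1 := fun h => hst (Prod.ext h h2)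
        have hrn : ‖r t.2‖ = ‖g t‖ := by
          have : ‖r t.2‖ ^ p = ‖g t‖ ^ p := by rw [← norm_pow, ← norm_pow, hr, hgp]
          exact (pow_left_inj₀ (norm_nonneg _) (norm_nonneg _) hpp.out.ne_zero).1 this
        have h3 : ‖g s - g t‖ = ‖1 - ζ‖ * ‖r t.2‖ := by
          simp only [hgdef, h2, ← sub_mul, norm_mul]
          congr 1
          rcases hs1 : s.1 <;> rcases ht1 : t.1 <;> simp_all [norm_sub_rev]
        rw [h3, hrn, hT _ _ (hgT t ht)]
      · by_contra! hlt
        have h3 := hsep _ (Finset.mem_product.1 hs).2 _ (Finset.mem_product.1 ht).2 h2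
        have h4 := norm_pow_sub_pow_le hζ (w := g s) (z := g t) (by
          rw [hT _ _ (hgT t ht)]; exact hlt.le)
        rw [hT _ _ (hgT t ht), one_pow, mul_one, hgp, hgp, add_sub_add_right_eq_sub] at h4
        exact absurd (h3.trans h4) (not_le.2 hlt)
    have hinj : Set.InjOn g ((Finset.univ : Finset Bool) ×ˢ F : Finset (Bool × Ω)) := by
      intro s hs t ht hst
      by_contra hne
      have := hgsep s hs t ht hne
      rw [hst, sub_self, norm_zero] at this
      exact absurd this (not_le.2 one_pos)
    refine ⟨((Finset.univ : Finset Bool) ×ˢ F).image g, ?_, ?_, ?_⟩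
    · rw [Finset.card_image_of_injOn hinj, Finset.card_product, hFc, pow_succ']
      simp
    · intro z hz
      obtain ⟨s, hs, rfl⟩ := Finset.mem_image.1 hz
      exact hgT s hs
    · intro z hz w hw hne
      obtain ⟨s, hs, rfl⟩ := Finset.mem_image.1 hz
      obtain ⟨t, ht, rfl⟩ := Finset.mem_image.1 hw
      exact hgsep s hs t ht (fun h => hne (by rw [h]))

/-- In the expanding case backward orbits are attracted by the ball of radius `q‖b‖`
around a fixed point `b`. -/
theorem exists_level_norm_sub_le (hζ : IsPrimitiveRoot ζ p) (hb : b ^ p = b + c)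
    (hqb : 1 < ‖1 - ζ‖ * ‖b‖) :
    ∃ N, ∀ n z, N ≤ n → (fun w : Ω => w ^ p - c)^[n] z = a → ‖z - b‖ ≤ ‖1 - ζ‖ * ‖b‖ := by
  -- Outside the ball, a step backwards extracts a `p`-th root of the distance to `b`; a point whose
  -- image lies in the ball lies in the ball.
  have key : ∀ n z, (fun w : Ω => w ^ p - c)^[n] z = a →
      ‖z - b‖ ≤ ‖1 - ζ‖ * ‖b‖ ∨ ‖z - b‖ ^ p ^ n ≤ ‖a - b‖ := by
    intro n
    induction n with
    | zero => intro z hz; right; rw [← hz]; simp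
    | succ n ih =>
      intro z hz
      rcases le_or_gt ‖z - b‖ (‖1 - ζ‖ * ‖b‖) with h | h
      · exact Or.inl h
      right
      have h1 := norm_pow_sub_pow_of_lt hζ h
      have h2 : z ^ p - b ^ p = z ^ p - c - b := by rw [hb]; ring
      rw [h2] at h1
      rcases ih _ hz with h3 | h3
      · rw [h1] at h3
        have h4 : ‖z - b‖ < ‖z - b‖ ^ p := lt_self_pow₀ (hqb.trans h) hpp.out.one_lt
        exact absurd (h4.trans_le h3) (not_lt.2 h.le)
      · rwa [h1, ← pow_mul, ← pow_succ'] at h3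
  obtain ⟨N, hN⟩ := pow_unbounded_of_one_lt ‖a - b‖ hqb
  refine ⟨N, fun n z hn hz => ?_⟩
  by_contra! hlt
  have h := (key n z hz).resolve_left hlt.not_ge
  have h1 : (‖1 - ζ‖ * ‖b‖) ^ N ≤ ‖z - b‖ ^ p ^ n :=
    (pow_le_pow_right₀ hqb.le (hn.trans (Nat.lt_pow_self hpp.out.one_lt).le)).trans
      (pow_le_pow_left₀ (by positivity) hlt.le _)
  exact absurd (hN.trans_le h1) (not_lt.2 h)

/-- Krasner's lemma for `p`-th roots in the expanding case: a `p`-th root `z` of `w + c`, for `w` in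
the ball around `b`, is closer to some `ηb` than to its conjugates `ζⁱz`. -/
theorem isometry_apply_eq_self (hζ : IsPrimitiveRoot ζ p) (hp : ‖(p : Ω)‖ = (p : ℝ)⁻¹)
    (hb : b ^ p = b + c) (hqb : 1 < ‖1 - ζ‖ * ‖b‖) {w z : Ω}
    (hw : ‖w - b‖ ≤ ‖1 - ζ‖ * ‖b‖) (hz : z ^ p = w + c) (σ : Ω →+* Ω)
    (hσ : ∀ x, ‖σ x‖ = ‖x‖) (hσζ : σ ζ = ζ) (hσb : σ b = b) (hσz : σ (z ^ p) = z ^ p) :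
    σ z = z := by
  have hd : z ^ p - b ^ p = w - b := by rw [hz, hb]; ring
  obtain ⟨η, hη, hηb⟩ : ∃ η ∈ nthRootsFinset p (1 : Ω), ‖z - η * b‖ < ‖1 - ζ‖ * ‖b‖ := by
    by_contra! h
    have h1 := Finset.prod_le_prod (s := nthRootsFinset p (1 : Ω)) (fun _ _ => by positivity) h
    rw [Finset.prod_const, hζ.card_nthRootsFinset, ← norm_prod,
      ← hζ.pow_sub_pow_eq_prod_sub_mul z b hpp.out.pos, hd] at h1
    exact absurd (lt_self_pow₀ hqb hpp.out.one_lt) (not_lt.2 (h1.trans hw))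
  have hη1 := (mem_nthRootsFinset hpp.out.pos _).1 hη
  have hησ : σ η = η := by
    obtain ⟨i, -, hi⟩ := hζ.eq_pow_of_pow_eq_one hη1
    rw [← hi, map_pow, hσζ]
  have hηb' : ‖η * b‖ = ‖b‖ := by rw [norm_mul, norm_eq_one_of_pow_eq_one hη1, one_mul]
  have hzb : ‖z‖ = ‖b‖ := by
    rw [← hηb']
    refine norm_eq_of_norm_sub_lt (hηb.trans_le ?_)
    rw [hηb']
    exact mul_le_of_le_one_left (norm_nonneg _) (norm_one_sub_lt_one hζ hp).le
  have hz0 : z ≠ 0 := by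
    rintro rfl
    rw [norm_zero] at hzb
    rw [← hzb, mul_zero] at hqb
    exact absurd hqb (not_lt.2 zero_le_one)
  by_contra hne
  have hr : (σ z / z) ^ p = 1 := by
    rw [div_pow, ← map_pow, hσz, div_self (pow_ne_zero _ hz0)]
  have hr1 : σ z / z ≠ 1 := fun h => hne (by rwa [div_eq_one_iff_eq hz0] at h)
  have h1 : ‖z - σ z‖ = ‖1 - ζ‖ * ‖b‖ := by
    rw [← norm_one_sub_eq hζ hr hr1, ← hzb, ← norm_mul]
    congr 1
    field_simp
  have h2 : z - σ z = (z - η * b) + -σ (z - η * b) := by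
    rw [map_sub, map_mul, hησ, hσb]; ring
  have h3 : ‖z - σ z‖ < ‖1 - ζ‖ * ‖b‖ := by
    rw [h2]
    refine (IsUltrametricDist.norm_add_le_max _ _).trans_lt (max_lt hηb ?_)
    rwa [norm_neg, hσ]
  exact absurd h3 (not_lt.2 h1.ge)

end Regimes

/-! ### Fields generated by preimages -/

section Galois

variable {Ω : Type*} [NormedField Ω] [IsUltrametricDist Ω] {p : ℕ} [hpp : Fact p.Prime] {ζ : Ω}
  {a b c : Ω}

open scoped Classical in
/-- The Lagrange basis polynomials of integral nodes at pairwise distance `1` are integral. -/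
theorem norm_coeff_lagrangeBasis_le_one {s : Finset Ω} (hs : ∀ x ∈ s, ‖x‖ ≤ 1)
    (hsep : ∀ x ∈ s, ∀ y ∈ s, x ≠ y → ‖x - y‖ = 1) {i : Ω} (hi : i ∈ s) (k : ℕ) :
    ‖(Lagrange.basis s id i).coeff k‖ ≤ 1 := by
  let O : Subring Ω := (NormedField.valuation (K := Ω)).integer
  have hO : ∀ x : Ω, x ∈ O ↔ ‖x‖ ≤ 1 := fun x => Iff.rfl
  have hC : ∀ x : Ω, ‖x‖ ≤ 1 → (C x : Polynomial Ω) ∈ lifts O.subtype := fun x hx =>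
    C_mem_lifts O.subtype ⟨x, hx⟩
  have h : Lagrange.basis s id i ∈ lifts O.subtype := by
    refine Subsemiring.prod_mem _ fun j hj => ?_
    have hj' := Finset.mem_erase.1 hj
    refine Subsemiring.mul_mem _ (hC _ ?_) ?_
    · rw [norm_inv, id, id, hsep i hi j hj'.2 hj'.1.symm, inv_one]
    · rw [sub_eq_add_neg, ← C_neg]
      exact Subsemiring.add_mem _ (X_mem_lifts _) (hC _ (by rw [norm_neg]; exact hs j hj'.2))
  obtain ⟨y, hy⟩ := (lifts_iff_coeff_lifts _).1 h k
  rw [← hy]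
  exact y.2

open scoped Classical in
/-- An integral element whose conjugates are at pairwise distance `1` generates an extension with
the same norms: the coefficients of an element in the power basis are integral combinations of
its conjugates by Lagrange interpolation, so its norm is the largest norm of a coefficient. -/
theorem exists_norm_eq_of_mem_adjoin {L : Type*} [Field L] [Algebra L Ω] [IsGalois L Ω]
    (hσ : ∀ (σ : Ω ≃ₐ[L] Ω) (x : Ω), ‖σ x‖ = ‖x‖) {t : Ω} (ht : ‖t‖ ≤ 1)
    (hsep : ∀ σ : Ω ≃ₐ[L] Ω, σ t ≠ t → ‖σ t - t‖ = 1) {x : Ω}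
    (hx : x ∈ IntermediateField.adjoin L {t}) : ∃ y : L, ‖algebraMap L Ω y‖ = ‖x‖ := by
  have hint : IsIntegral L t := Algebra.IsIntegral.isIntegral t
  obtain ⟨P, hPdeg, rfl⟩ : ∃ P : Polynomial L, P.degree < (minpoly L t).degree ∧
      aeval t P = x := by
    rw [← IntermediateField.mem_toSubalgebra,
      IntermediateField.adjoin_simple_toSubalgebra_of_isAlgebraic hint.isAlgebraic,
      Algebra.adjoin_singleton_eq_range_aeval] at hx
    obtain ⟨P, rfl⟩ := hx
    exact ⟨P %ₘ minpoly L t, degree_modByMonic_lt _ (minpoly.monic hint),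
      minpoly.aeval_modByMonic_minpoly P t⟩
  set s : Finset Ω := ((minpoly L t).aroots Ω).toFinset with hs
  have hcard : s.card = (minpoly L t).natDegree := by
    rw [← card_rootSet_eq_natDegree (Algebra.IsSeparable.isSeparable L t)
      (Normal.splits inferInstance t), Fintype.card_of_subtype s]
    intro y
    simp [hs, mem_rootSet']
  have hconj : ∀ y ∈ s, ∃ σ : Ω ≃ₐ[L] Ω, σ t = y := by
    intro y hy
    have hroot : aeval y (minpoly L t) = 0 := by
      rw [hs, Multiset.mem_toFinset, mem_aroots] at hy
      exact hy.2
    have : IsConjRoot L y t :=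
      (minpoly.eq_of_irreducible_of_monic (minpoly.irreducible hint) hroot
        (minpoly.monic hint)).symm
    exact isConjRoot_iff_exists_algEquiv.1 this
  have hs1 : ∀ y ∈ s, ‖y‖ ≤ 1 := by
    intro y hy
    obtain ⟨σ, rfl⟩ := hconj y hy
    rwa [hσ]
  have hs2 : ∀ y ∈ s, ∀ z ∈ s, y ≠ z → ‖y - z‖ = 1 := by
    intro y hy z hz hyz
    obtain ⟨σ, rfl⟩ := hconj y hy
    obtain ⟨τ, rfl⟩ := hconj z hz
    have h1 : σ t - τ t = τ ((τ⁻¹ * σ) t - t) := by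
      rw [map_sub, AlgEquiv.mul_apply, ← AlgEquiv.mul_apply τ, mul_inv_cancel, AlgEquiv.one_apply]
    rw [h1, hσ]
    refine hsep _ fun h => hyz ?_
    rw [← sub_eq_zero, h1, h, sub_self, map_zero]
  set Q : Polynomial Ω := P.map (algebraMap L Ω) with hQ
  have hQdeg : Q.degree < s.card := by
    rw [hQ, degree_map, hcard, ← degree_eq_natDegree (minpoly.ne_zero hint)]
    exact hPdeg
  have hcoeff : ∀ k, ‖Q.coeff k‖ ≤ ‖aeval t P‖ := by
    intro k
    rw [Lagrange.eq_interpolate (v := id) Function.injective_id.injOn hQdeg,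
      Lagrange.interpolate_apply, finsetSum_coeff]
    refine IsUltrametricDist.norm_sum_le_of_forall_le_of_nonneg (norm_nonneg _) fun y hy => ?_
    obtain ⟨σ, hσy⟩ := hconj y hy
    have h1 : Q.eval y = σ (aeval t P) := by
      rw [hQ, eval_map, ← aeval_def, ← hσy, ← aeval_algHom_apply]
    rw [coeff_C_mul, norm_mul, id, h1, hσ]
    exact mul_le_of_le_one_right (norm_nonneg _) (norm_coeff_lagrangeBasis_le_one hs1 hs2 hy k)
  by_cases hx0 : aeval t P = 0
  · exact ⟨0, by rw [hx0, map_zero]⟩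
  have hsum : aeval t P = ∑ k ∈ Finset.range (Q.natDegree + 1), Q.coeff k * t ^ k := by
    rw [aeval_def, ← eval_map, eval_eq_sum_range]
  obtain ⟨k, -, hk⟩ := IsUltrametricDist.exists_norm_finsetSum_le
    (Finset.range (Q.natDegree + 1)) (fun k => Q.coeff k * t ^ k)
  refine ⟨P.coeff k, ?_⟩
  rw [← coeff_map]
  refine le_antisymm (hcoeff k) ?_
  rw [hsum]
  refine hk.trans ?_
  rw [norm_mul, norm_pow]
  exact mul_le_of_le_one_right (norm_nonneg _) (pow_le_one₀ (norm_nonneg _) ht)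

variable {K : Type*} [Field K] [Algebra K Ω] [IsGalois K Ω]

/-- When all preimages lie in the unit ball around `b` and `q‖b‖ = 1`, adjoining them to a field
containing `a` and `b` creates no new norms. A maximal field with the given bound on the
denominators is closed under the `p`-th roots in question. -/
theorem exists_intermediateField_normsInRootsOfPrime (hζ : IsPrimitiveRoot ζ p)
    (hσ : ∀ (σ : Ω ≃ₐ[K] Ω) (x : Ω), ‖σ x‖ = ‖x‖) (hb : b ^ p = b + c)
    (hT : ∀ n z, (fun w : Ω => w ^ p - c)^[n] z = a → ‖z - b‖ ≤ 1 ∧ ‖1 - ζ‖ * ‖z‖ = 1)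
    {M : ℕ} {L₀ : IntermediateField K Ω} (ha : a ∈ L₀) (hbL : b ∈ L₀)
    (hL₀ : NormsInRootsOfPrime p M L₀.toSubfield) :
    ∃ L : IntermediateField K Ω, NormsInRootsOfPrime p M L.toSubfield ∧
      ∀ n z, (fun w : Ω => w ^ p - c)^[n] z = a → z ∈ L := by
  obtain ⟨L, hL₀L, hLmax⟩ := zorn_le_nonempty₀
    {L : IntermediateField K Ω | NormsInRootsOfPrime p M L.toSubfield} (by
      intro C hC hchain y hy
      refine ⟨sSup C, ?_, fun z hz => le_sSup hz⟩
      intro x hx hx0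
      have : Nonempty C := ⟨⟨y, hy⟩⟩
      rw [sSup_eq_iSup'] at hx
      have hx' : x ∈ (⨆ i : C, (i : IntermediateField K Ω)) := hx
      rw [← SetLike.mem_coe, IntermediateField.coe_iSup_of_directed
        (hchain.directedOn.directed_val), Set.mem_iUnion] at hx'
      obtain ⟨i, hi⟩ := hx'
      exact hC i.2 x hi hx0) L₀ hL₀
  have hL : NormsInRootsOfPrime p M L.toSubfield := hLmax.prop
  refine ⟨L, hL, fun n => ?_⟩
  induction n with
  | zero => rintro z rfl; exact hL₀L ha
  | succ n ih =>
    intro z hz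
    have hw := ih (z ^ p - c) hz
    have hbL' : b ∈ L := hL₀L hbL
    have hzp : z ^ p ∈ L := by
      have : z ^ p = (z ^ p - c) + (b ^ p - b) := by rw [hb]; ring
      rw [this]
      exact L.add_mem hw (L.sub_mem (pow_mem hbL' p) hbL')
    have hz0 : z ≠ 0 := by
      rintro rfl
      simpa using (hT _ _ hz).2
    -- The conjugates of `z` over `L` are among the `ηz` with `η ^ p = 1`.
    have hsep : ∀ σ : Ω ≃ₐ[L] Ω, σ (z - b) ≠ z - b → ‖σ (z - b) - (z - b)‖ = 1 := by
      intro σ hne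
      have hσb : σ b = b := σ.commutes ⟨b, hbL'⟩
      have hσz : σ (z ^ p) = z ^ p := σ.commutes ⟨z ^ p, hzp⟩
      rw [map_sub, hσb] at hne ⊢
      have hr : (σ z / z) ^ p = 1 := by
        rw [div_pow, ← map_pow, hσz, div_self (pow_ne_zero _ hz0)]
      have hr1 : σ z / z ≠ 1 := fun h => hne (by rw [(div_eq_one_iff_eq hz0).1 h])
      rw [sub_sub_sub_cancel_right, ← (hT _ _ hz).2, ← norm_one_sub_eq hζ hr hr1, ← norm_mul,
        norm_sub_rev]
      congr 1
      field_simp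
    have hnorm := fun x hx => exists_norm_eq_of_mem_adjoin (L := L) (x := x)
      (fun σ => hσ (σ.restrictScalars K)) (hT _ _ hz).1 hsep hx
    have hle : L ≤ (IntermediateField.adjoin L {z - b}).restrictScalars K := by
      intro y hy
      exact (IntermediateField.adjoin L {z - b}).algebraMap_mem ⟨y, hy⟩
    have hmem : z - b ∈ L := by
      refine hLmax.le_of_ge (y := (IntermediateField.adjoin L {z - b}).restrictScalars K) ?_ hle
        (IntermediateField.mem_adjoin_simple_self L (z - b))
      intro x hx hx0
      obtain ⟨y, hy⟩ := hnorm x hx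
      rw [← hy]
      refine hL _ y.2 fun h => hx0 (norm_eq_zero.1 ?_)
      rw [← hy]
      exact norm_eq_zero.2 h
    have := L.add_mem hmem hbL'
    rwa [sub_add_cancel] at this

/-- In the expanding case, a field that contains `ζ`, a fixed point and all preimages up to the
level from which backward orbits stay in the attracting ball contains all preimages. -/
theorem mem_of_forall_level_le (hζ : IsPrimitiveRoot ζ p) (hp : ‖(p : Ω)‖ = (p : ℝ)⁻¹)
    (hσ : ∀ (σ : Ω ≃ₐ[K] Ω) (x : Ω), ‖σ x‖ = ‖x‖) (hb : b ^ p = b + c)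
    (hqb : 1 < ‖1 - ζ‖ * ‖b‖) {N : ℕ}
    (hN : ∀ n z, N ≤ n → (fun w : Ω => w ^ p - c)^[n] z = a → ‖z - b‖ ≤ ‖1 - ζ‖ * ‖b‖)
    {L : IntermediateField K Ω} (hζL : ζ ∈ L) (hbL : b ∈ L)
    (hL : ∀ n z, n ≤ N → (fun w : Ω => w ^ p - c)^[n] z = a → z ∈ L) (n : ℕ) {z : Ω}
    (hz : (fun w : Ω => w ^ p - c)^[n] z = a) : z ∈ L := by
  rcases le_total n N with hn | hn
  · exact hL n z hn hz
  induction n, hn using Nat.le_induction generalizing z with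
  | base => exact hL N z le_rfl hz
  | succ n hn ih =>
    have hw := ih (z := z ^ p - c) hz
    have hzp : z ^ p ∈ L := by
      have : z ^ p = (z ^ p - c) + (b ^ p - b) := by rw [hb]; ring
      rw [this]
      exact L.add_mem hw (L.sub_mem (pow_mem hbL p) hbL)
    have : z ∈ (⊥ : IntermediateField L Ω) := by
      rw [InfiniteGalois.mem_bot_iff_fixed]
      intro σ
      exact isometry_apply_eq_self hζ hp hb hqb (hN n _ hn hz) (sub_add_cancel (z ^ p) c).symm
        (σ : Ω →+* Ω) (fun x => hσ (σ.restrictScalars K) x) (σ.commutes ⟨ζ, hζL⟩)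
        (σ.commutes ⟨b, hbL⟩) (σ.commutes ⟨z ^ p, hzp⟩)
    obtain ⟨y, rfl⟩ := IntermediateField.mem_bot.1 this
    exact y.2

omit [IsUltrametricDist Ω] in
/-- A bounded part of a finite-dimensional space over a locally compact field contains only
finitely many points at pairwise distance at least `1`. -/
theorem exists_card_le_of_separated {𝕜 : Type*} [NontriviallyNormedField 𝕜] [ProperSpace 𝕜]
    [NormedSpace 𝕜 Ω] (V : Submodule 𝕜 Ω) [FiniteDimensional 𝕜 V] (R : ℝ) :
    ∃ N : ℕ, ∀ F : Finset Ω, (∀ z ∈ F, z ∈ V ∧ ‖z‖ ≤ R) →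
      (∀ z ∈ F, ∀ w ∈ F, z ≠ w → 1 ≤ ‖z - w‖) → F.card ≤ N := by
  have : ProperSpace V := FiniteDimensional.proper 𝕜 V
  obtain ⟨t, htf, ht⟩ := Metric.totallyBounded_iff.1
    (isCompact_closedBall (0 : V) R).totallyBounded (1 / 2) (by norm_num)
  refine ⟨htf.toFinset.card, fun F hF hsep => ?_⟩
  have h : ∀ z ∈ F, ∃ y ∈ t, ‖z - (y : Ω)‖ < 1 / 2 := by
    intro z hz
    have hzb : (⟨z, (hF z hz).1⟩ : V) ∈ Metric.closedBall (0 : V) R := by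
      rw [mem_closedBall_zero_iff]
      exact (hF z hz).2
    obtain ⟨y, hy, hzy⟩ := Set.mem_iUnion₂.1 (ht hzb)
    exact ⟨y, hy, by simpa [dist_eq_norm] using hzy⟩
  choose! g hgt hg using h
  refine Finset.card_le_card_of_injOn g (fun z hz => htf.mem_toFinset.2 (hgt z hz)) ?_
  intro z hz w hw hzw
  by_contra hne
  have h1 := hg z hz
  have h2 := hg w hw
  rw [norm_sub_rev, ← hzw] at h2
  have h3 := norm_add_le (z - g z : Ω) (g z - w)
  rw [sub_add_sub_cancel] at h3
  linarith [hsep z hz w hw hne]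

end Galois

/-! ### Value groups and ramification -/

section Ramification

variable {p : ℕ} [hpp : Fact p.Prime] {Ω : Type*} [NormedField Ω] [Algebra ℚ_[p] Ω]
  [Algebra.IsAlgebraic ℚ_[p] Ω]

theorem val_eq_neg_logb (hN : ∀ x : Ω, ‖x‖ = spectralNorm ℚ_[p] Ω x) {x : Ω} (hx : x ≠ 0) :
    val p x = ((-Real.logb p ‖x‖ : ℝ) : WithTop ℝ) := by
  rw [hN]
  simp [val, AddValuation.of_apply, valFun, hx]

theorem val_nonneg_iff (hN : ∀ x : Ω, ‖x‖ = spectralNorm ℚ_[p] Ω x) {x : Ω} :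
    0 ≤ val p x ↔ ‖x‖ ≤ 1 := by
  have hp : (1 : ℝ) < p := by exact_mod_cast hpp.out.one_lt
  by_cases hx : x = 0
  · simp [hx]
  rw [val_eq_neg_logb hN hx, ← WithTop.coe_zero, WithTop.coe_le_coe, neg_nonneg,
    ← Real.logb_nonpos_iff hp (norm_pos_iff.2 hx)]

omit [Algebra ℚ_[p] Ω] [Algebra.IsAlgebraic ℚ_[p] Ω] in
/-- The comparison of `v(c)` with `-p / (p - 1)` in terms of `q = ‖1 - ζ‖`, for which
`v(1 - ζ) = 1 / (p - 1)`. -/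
theorem logb_norm_mul_pow {q : ℝ} (hq : 0 < q) (hqp : q ^ (p - 1) = (p : ℝ)⁻¹) {c : Ω}
    (hc : c ≠ 0) :
    Real.logb p (‖c‖ * q ^ p) = Real.logb p ‖c‖ - (p : ℝ) / ((p : ℝ) - 1) := by
  have hp : (1 : ℝ) < p := by exact_mod_cast hpp.out.one_lt
  have h1 : ((p : ℝ) - 1) * Real.logb p q = -1 := by
    have := congrArg (Real.logb p) hqp
    rwa [Real.logb_pow, Real.logb_inv, Real.logb_self_eq_one hp,
      Nat.cast_sub hpp.out.one_le, Nat.cast_one] at this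
  rw [Real.logb_mul (norm_ne_zero_iff.2 hc) (pow_pos hq p).ne', Real.logb_pow]
  have h2 : (p : ℝ) - 1 ≠ 0 := by linarith
  field_simp
  linear_combination (p : ℝ) * h1

theorem val_lt_iff (hN : ∀ x : Ω, ‖x‖ = spectralNorm ℚ_[p] Ω x) {q : ℝ} (hq : 0 < q)
    (hqp : q ^ (p - 1) = (p : ℝ)⁻¹) {c : Ω} (hc : c ≠ 0) :
    val p c < ((-(p : ℝ) / ((p : ℝ) - 1) : ℝ) : WithTop ℝ) ↔ 1 < ‖c‖ * q ^ p := by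
  have hp : (1 : ℝ) < p := by exact_mod_cast hpp.out.one_lt
  have hpos : 0 < ‖c‖ * q ^ p := mul_pos (norm_pos_iff.2 hc) (pow_pos hq p)
  rw [val_eq_neg_logb hN hc, WithTop.coe_lt_coe, ← Real.logb_pos_iff hp hpos,
    logb_norm_mul_pow hq hqp hc, neg_div, neg_lt_neg_iff, sub_pos]

theorem lt_val_iff (hN : ∀ x : Ω, ‖x‖ = spectralNorm ℚ_[p] Ω x) {q : ℝ} (hq : 0 < q)
    (hqp : q ^ (p - 1) = (p : ℝ)⁻¹) {c : Ω} (hc : c ≠ 0) :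
    ((-(p : ℝ) / ((p : ℝ) - 1) : ℝ) : WithTop ℝ) < val p c ↔ ‖c‖ * q ^ p < 1 := by
  have hp : (1 : ℝ) < p := by exact_mod_cast hpp.out.one_lt
  have hpos : 0 < ‖c‖ * q ^ p := mul_pos (norm_pos_iff.2 hc) (pow_pos hq p)
  rw [val_eq_neg_logb hN hc, WithTop.coe_lt_coe, ← Real.logb_neg_iff hp hpos,
    logb_norm_mul_pow hq hqp hc, neg_div, neg_lt_neg_iff, sub_neg]

variable {K : Type*} [Field K] [Algebra K Ω]

theorem mem_valueGroup_iff (hN : ∀ x : Ω, ‖x‖ = spectralNorm ℚ_[p] Ω x)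
    {L : IntermediateField K Ω} {r : ℝ} :
    r ∈ valueGroup p L ↔ ∃ x ∈ L, x ≠ 0 ∧ -Real.logb p ‖x‖ = r := by
  constructor
  · rintro ⟨x, hx, hr⟩
    have hx0 : x ≠ 0 := by
      rintro rfl
      rw [AddValuation.map_zero] at hr
      exact WithTop.top_ne_coe hr
    rw [val_eq_neg_logb hN hx0, WithTop.coe_inj] at hr
    exact ⟨x, hx, hx0, hr⟩
  · rintro ⟨x, hx, hx0, rfl⟩
    exact ⟨x, hx, val_eq_neg_logb hN hx0⟩

/-- The multiplicative bound on denominators, in terms of the additive value group. -/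
theorem normsInRootsOfPrime_iff (hN : ∀ x : Ω, ‖x‖ = spectralNorm ℚ_[p] Ω x)
    {L : IntermediateField K Ω} {M : ℕ} :
    NormsInRootsOfPrime p M L.toSubfield ↔ ∀ r ∈ valueGroup p L, ∃ k : ℤ, M * r = k := by
  have hp : (1 : ℝ) < p := by exact_mod_cast hpp.out.one_lt
  have key : ∀ x : Ω, x ≠ 0 → ∀ k : ℤ,
      ‖x‖ ^ M = (p : ℝ) ^ k ↔ M * -Real.logb p ‖x‖ = ((-k : ℤ) : ℝ) := by
    intro x hx k
    have hx' := norm_pos_iff.2 hx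
    rw [mul_neg, ← Real.logb_pow, Int.cast_neg, neg_inj]
    rw [Real.logb_eq_iff_rpow_eq (by linarith) hp.ne' (pow_pos hx' M), Real.rpow_intCast, eq_comm]
  constructor
  · intro h r hr
    obtain ⟨x, hx, hx0, rfl⟩ := (mem_valueGroup_iff hN).1 hr
    obtain ⟨k, hk⟩ := h x hx hx0
    exact ⟨-k, (key x hx0 k).1 hk⟩
  · intro h x hx hx0
    obtain ⟨k, hk⟩ := h _ ((mem_valueGroup_iff hN).2 ⟨x, hx, hx0, rfl⟩)
    exact ⟨-k, (key x hx0 (-k)).2 (by rw [neg_neg]; exact hk)⟩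

omit [Algebra.IsAlgebraic ℚ_[p] Ω] in
/-- The norm of `x` is a root, of degree that of `x`, of the norm of the constant coefficient of its
minimal polynomial over `ℚ_p`. -/
theorem normsInRootsOfPrime_finrank [Algebra ℚ_[p] K] [IsScalarTower ℚ_[p] K Ω]
    (hN : ∀ x : Ω, ‖x‖ = spectralNorm ℚ_[p] Ω x) (L : IntermediateField K Ω)
    [FiniteDimensional ℚ_[p] L] :
    NormsInRootsOfPrime p (Module.finrank ℚ_[p] L) L.toSubfield := by
  intro x hx hx0
  have : IsScalarTower ℚ_[p] L Ω := ⟨fun r y z => smul_mul_assoc r (y : Ω) z⟩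
  have hint : IsIntegral ℚ_[p] (⟨x, hx⟩ : L) := Algebra.IsIntegral.isIntegral _
  obtain ⟨m, hm⟩ := minpoly.degree_dvd hint
  have h1 : ‖x‖ ^ (minpoly ℚ_[p] (⟨x, hx⟩ : L)).natDegree
      = ‖(minpoly ℚ_[p] (⟨x, hx⟩ : L)).coeff 0‖ := by
    have h2 := spectralNorm.spectralNorm_eq_norm_coeff_zero_rpow ℚ_[p] L ⟨x, hx⟩
    rw [spectralNorm.eq_of_tower (E := L) (L := Ω)] at h2
    rw [hN]
    refine (congrArg (· ^ _) h2).trans ?_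
    rw [one_div, Real.rpow_inv_natCast_pow (norm_nonneg _) (minpoly.natDegree_pos hint).ne']
  have h3 : (minpoly ℚ_[p] (⟨x, hx⟩ : L)).coeff 0 ≠ 0 := by
    refine minpoly.coeff_zero_ne_zero hint fun h => hx0 ?_
    exact congrArg Subtype.val h
  refine ⟨-((minpoly ℚ_[p] (⟨x, hx⟩ : L)).coeff 0).valuation * m, ?_⟩
  rw [hm, pow_mul, h1, Padic.norm_eq_zpow_neg_valuation h3, zpow_mul, zpow_natCast]

variable [Algebra ℚ_[p] K] [FiniteDimensional ℚ_[p] K] [IsScalarTower ℚ_[p] K Ω]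

theorem FinitelyRamified.exists_normsInRootsOfPrime (hN : ∀ x : Ω, ‖x‖ = spectralNorm ℚ_[p] Ω x)
    {L : IntermediateField K Ω} (hL : FinitelyRamified p L) :
    ∃ M : ℕ, 0 < M ∧ NormsInRootsOfPrime p M L.toSubfield := by
  have : FiniteDimensional ℚ_[p] (⊥ : IntermediateField K Ω) := FiniteDimensional.trans ℚ_[p] K _
  have h0 := (normsInRootsOfPrime_iff hN).1
    (normsInRootsOfPrime_finrank hN (⊥ : IntermediateField K Ω))
  set H := (valueGroup p (⊥ : IntermediateField K Ω)).addSubgroupOf (valueGroup p L)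
  have hH : H.index ≠ 0 := hL.index_ne_zero
  refine ⟨Module.finrank ℚ_[p] (⊥ : IntermediateField K Ω) * H.index,
    Nat.mul_pos Module.finrank_pos (Nat.pos_of_ne_zero hH), (normsInRootsOfPrime_iff hN).2 ?_⟩
  intro r hr
  have h1 : H.index • (⟨r, hr⟩ : valueGroup p L) ∈ H := AddSubgroup.nsmul_index_mem H _
  obtain ⟨k, hk⟩ := h0 _ (AddSubgroup.mem_addSubgroupOf.1 h1)
  refine ⟨k, ?_⟩
  rw [← hk]
  simp [mul_assoc]

omit [Algebra ℚ_[p] K] [FiniteDimensional ℚ_[p] K] [IsScalarTower ℚ_[p] K Ω] in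
theorem finitelyRamified_of_normsInRootsOfPrime (hN : ∀ x : Ω, ‖x‖ = spectralNorm ℚ_[p] Ω x)
    {L : IntermediateField K Ω} {M : ℕ} (hM : 0 < M)
    (hL : NormsInRootsOfPrime p M L.toSubfield) : FinitelyRamified p L := by
  choose! k hk using (normsInRootsOfPrime_iff hN).1 hL
  have : NeZero M := ⟨hM.ne'⟩
  have hM' : (M : ℝ) ≠ 0 := by exact_mod_cast hM.ne'
  -- The value group maps to `ℤ/M` by `r ↦ M * r`, and the kernel consists of integers, which are
  -- values of powers of `p`.
  let φ : valueGroup p L →+ ZMod M := AddMonoidHom.mk' (fun r => (k r : ZMod M)) (by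
    intro r s
    rw [← Int.cast_add]
    congr 1
    have h1 := hk _ (r + s).2
    rw [AddSubgroup.coe_add, mul_add, hk _ r.2, hk _ s.2] at h1
    exact_mod_cast h1.symm)
  have hφ : φ.ker.FiniteIndex := inferInstance
  refine AddSubgroup.finiteIndex_of_le (H := φ.ker) ?_
  intro r hr
  rw [AddSubgroup.mem_addSubgroupOf]
  have h1 : ((k r : ℤ) : ZMod M) = 0 := hr
  rw [ZMod.intCast_zmod_eq_zero_iff_dvd] at h1
  obtain ⟨m, hm⟩ := h1
  have h2 := hk _ r.2
  rw [hm] at h2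
  push_cast at h2
  have h3 : (r : ℝ) = m • (1 : ℝ) := by
    rw [zsmul_eq_mul, mul_one]
    exact mul_left_cancel₀ hM' h2
  rw [h3]
  have h4 : (1 : ℝ) ∈ valueGroup p (⊥ : IntermediateField K Ω) :=
    ⟨(p : Ω), natCast_mem _ p, val_prime p⟩
  exact AddSubgroup.zsmul_mem _ h4 m

end Ramification

/-! ### The arboreal extension -/

section Assembly

open scoped Classical in
theorem finite_iterate_pow_sub_eq {R : Type*} [CommRing R] [IsDomain R] {p : ℕ} (hp : 0 < p)
    (c a : R) (n : ℕ) : {z : R | (fun w : R => w ^ p - c)^[n] z = a}.Finite := by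
  induction n with
  | zero => exact Set.finite_singleton a
  | succ n ih =>
    have h : {z : R | (fun w : R => w ^ p - c)^[n + 1] z = a} =
        (fun w : R => w ^ p - c) ⁻¹' {z : R | (fun w : R => w ^ p - c)^[n] z = a} := by
      ext z; rfl
    rw [h]
    refine ih.preimage' fun w _ => ?_
    refine (nthRoots p (w + c)).toFinset.finite_toSet.subset fun z hz => ?_
    have hz' : z ^ p - c = w := hz
    rw [Finset.mem_coe, Multiset.mem_toFinset, mem_nthRoots hp, ← hz', sub_add_cancel]

variable {p : ℕ} {K : Type*} [Field K] {Ω : Type*} [Field Ω] [Algebra K Ω]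

theorem mem_iteratedPreimage_iff {a c : K} {n : ℕ} {z : Ω} :
    z ∈ iteratedPreimage Ω (X ^ p - C c) a n ↔
      (fun w : Ω => w ^ p - algebraMap K Ω c)^[n] z = algebraMap K Ω a := by
  simp [iteratedPreimage]

theorem mem_arborealFieldInfty {a c : K} {n : ℕ} {z : Ω}
    (hz : (fun w : Ω => w ^ p - algebraMap K Ω c)^[n] z = algebraMap K Ω a) :
    z ∈ arborealFieldInfty Ω (X ^ p - C c) a :=
  le_iSup (fun n => arborealField Ω (X ^ p - C c) a n) n
    (IntermediateField.subset_adjoin K _ (mem_iteratedPreimage_iff.2 hz))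

theorem arborealFieldInfty_le {a c : K} {L : IntermediateField K Ω}
    (hL : ∀ n z, (fun w : Ω => w ^ p - algebraMap K Ω c)^[n] z = algebraMap K Ω a → z ∈ L) :
    arborealFieldInfty Ω (X ^ p - C c) a ≤ L :=
  iSup_le fun n => IntermediateField.adjoin_le_iff.2 fun z hz =>
    hL n z (mem_iteratedPreimage_iff.1 hz)

end Assembly

section Main

variable {p : ℕ} [hpp : Fact p.Prime] {K : Type*} [Field K] {Ω : Type*} [NormedField Ω]
  [IsUltrametricDist Ω] [IsAlgClosed Ω] [Algebra K Ω] [IsGalois K Ω] {ζ : Ω} {a c : K}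

/-- In the expanding case finitely many levels of preimages, together with `ζ` and a fixed point,
generate a field that contains all preimages. -/
theorem finiteDimensional_arborealFieldInfty (hζ : IsPrimitiveRoot ζ p)
    (hp : ‖(p : Ω)‖ = (p : ℝ)⁻¹) (hσ : ∀ (σ : Ω ≃ₐ[K] Ω) (x : Ω), ‖σ x‖ = ‖x‖)
    (hc : 1 < ‖algebraMap K Ω c‖ * ‖1 - ζ‖ ^ p) :
    FiniteDimensional K (arborealFieldInfty Ω (X ^ p - C c) a) := by
  obtain ⟨b, hb⟩ := exists_fixedPoint (p := p) (algebraMap K Ω c)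
  have hc1 : 1 < ‖algebraMap K Ω c‖ := hc.trans_le
    (mul_le_of_le_one_right (norm_nonneg _)
      (pow_le_one₀ (norm_nonneg _) (norm_one_sub_lt_one hζ hp).le))
  have hqb : 1 < ‖1 - ζ‖ * ‖b‖ := by
    by_contra! h
    have := pow_le_one₀ (n := p) (by positivity) h
    rw [mul_pow, norm_fixedPoint_pow hb hc1, mul_comm] at this
    exact absurd hc (not_lt.2 this)
  obtain ⟨N, hN⟩ := exists_level_norm_sub_le (a := algebraMap K Ω a) hζ hb hqb
  set S : Set Ω := {ζ, b} ∪ ⋃ n ∈ Finset.range (N + 1),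
    {z : Ω | (fun w : Ω => w ^ p - algebraMap K Ω c)^[n] z = algebraMap K Ω a} with hS
  have hfin : S.Finite := (Set.toFinite _).union (Set.Finite.biUnion (Finset.finite_toSet _)
    fun n _ => finite_iterate_pow_sub_eq hpp.out.pos _ _ n)
  have : Finite S := hfin
  have hfd : FiniteDimensional K (IntermediateField.adjoin K S) :=
    IntermediateField.finiteDimensional_adjoin fun x _ => Algebra.IsIntegral.isIntegral x
  have hsub := IntermediateField.subset_adjoin K S
  have hle : arborealFieldInfty Ω (X ^ p - C c) a ≤ IntermediateField.adjoin K S :=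
    arborealFieldInfty_le fun n z hz =>
      mem_of_forall_level_le hζ hp hσ hb hqb hN (hsub (by simp [hS])) (hsub (by simp [hS]))
        (fun m y hm hy => hsub (Or.inr (Set.mem_iUnion₂.2
          ⟨m, Finset.mem_range.2 (Nat.lt_succ_of_le hm), hy⟩))) n hz
  exact Module.Finite.of_injective (IntermediateField.inclusion hle).toLinearMap
    (IntermediateField.inclusion hle).injective

variable [Algebra ℚ_[p] Ω] [Algebra.IsAlgebraic ℚ_[p] Ω] [Algebra ℚ_[p] K]
  [FiniteDimensional ℚ_[p] K] [IsScalarTower ℚ_[p] K Ω]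

omit [IsGalois K Ω] in
theorem not_finitelyRamified_of_norm_mul_pow_lt_one
    (hN : ∀ x : Ω, ‖x‖ = spectralNorm ℚ_[p] Ω x) (hζ : IsPrimitiveRoot ζ p)
    (hp : ‖(p : Ω)‖ = (p : ℝ)⁻¹) (hc0 : c ≠ 0)
    (hc : ‖algebraMap K Ω c‖ * ‖1 - ζ‖ ^ p < 1) :
    ¬ FinitelyRamified p (arborealFieldInfty Ω (X ^ p - C c) a) := by
  intro h
  obtain ⟨M, hM, hnorm⟩ := h.exists_normsInRootsOfPrime hN
  rcases lt_or_ge 1 ‖algebraMap K Ω c‖ with hc1 | hc1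
  · exact not_normsInRootsOfPrime_of_one_lt hζ hc1 hc hM
      (fun n z hz => mem_arborealFieldInfty hz) hnorm
  · exact not_normsInRootsOfPrime_of_le_one hζ hp (by simpa using hc0) hc1 hM
      (fun n z hz => mem_arborealFieldInfty hz) hnorm

/-- In the critical case `‖c‖q ^ p = 1` a fixed point `b` has `q‖b‖ = 1`, so that distinct `p`-th
roots of an element of norm `‖c‖` are at distance `1`. If `a` is far from `b`, backward orbits of
`a` produce ever new denominators; if `a` is in the unit ball around `b`, the extension is
unramified over `K(b)`, but its residue field is infinite. -/
theorem not_finiteDimensional_and_finitelyRamified_iff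
    (hN : ∀ x : Ω, ‖x‖ = spectralNorm ℚ_[p] Ω x) (hζ : IsPrimitiveRoot ζ p)
    (hp : ‖(p : Ω)‖ = (p : ℝ)⁻¹) (hσ : ∀ (σ : Ω ≃ₐ[K] Ω) (x : Ω), ‖σ x‖ = ‖x‖)
    (hc : ‖algebraMap K Ω c‖ * ‖1 - ζ‖ ^ p = 1) {b : Ω} (hb : b ^ p = b + algebraMap K Ω c) :
    ¬ FiniteDimensional K (arborealFieldInfty Ω (X ^ p - C c) a) ∧
      (FinitelyRamified p (arborealFieldInfty Ω (X ^ p - C c) a) ↔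
        ‖algebraMap K Ω a - b‖ ≤ 1) := by
  have hq1 := norm_one_sub_lt_one hζ hp
  have hc1 : 1 < ‖algebraMap K Ω c‖ := by
    by_contra! h
    have h1 : ‖1 - ζ‖ ^ p < 1 := pow_lt_one₀ (norm_nonneg _) hq1 hpp.out.ne_zero
    exact absurd hc (mul_lt_one_of_nonneg_of_lt_one_right h (by positivity) h1).ne
  have hqb : ‖1 - ζ‖ * ‖b‖ = 1 := by
    rw [← pow_eq_one_iff_of_nonneg (by positivity) hpp.out.ne_zero, mul_pow,
      norm_fixedPoint_pow hb hc1, mul_comm, hc]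
  have hb1 : 1 < ‖b‖ := by
    by_contra! h
    exact absurd hqb (mul_lt_one_of_nonneg_of_lt_one_left (norm_nonneg _) hq1 h).ne
  have hfar : 1 < ‖algebraMap K Ω a - b‖ → ∀ M : ℕ, 0 < M →
      ¬ NormsInRootsOfPrime p M (arborealFieldInfty Ω (X ^ p - C c) a).toSubfield :=
    fun ha M hM => not_normsInRootsOfPrime_of_one_lt_norm_sub hζ hb hqb.le ha hM
      fun n z hz => mem_arborealFieldInfty hz
  have hT : ‖algebraMap K Ω a - b‖ ≤ 1 → ∀ n z,
      (fun w : Ω => w ^ p - algebraMap K Ω c)^[n] z = algebraMap K Ω a →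
      ‖z - b‖ ≤ 1 ∧ ‖z‖ = ‖b‖ := fun ha n z hz =>
    have h := norm_sub_fixedPoint_le_one hζ hb hqb.le ha hz
    ⟨h, norm_eq_of_norm_sub_lt (h.trans_lt hb1)⟩
  refine ⟨fun hfd => ?_, fun h => ?_, fun ha => ?_⟩
  · have hfd' : FiniteDimensional ℚ_[p] (arborealFieldInfty Ω (X ^ p - C c) a) :=
      FiniteDimensional.trans ℚ_[p] K _
    rcases lt_or_ge 1 ‖algebraMap K Ω a - b‖ with ha | ha
    · exact hfar ha _ Module.finrank_pos (normsInRootsOfPrime_finrank hN _)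
    let : NormedSpace ℚ_[p] Ω :=
      { norm_smul_le := fun r x => by
          rw [Algebra.smul_def, norm_mul, hN (algebraMap _ _ r), spectralNorm_extends] }
    let V : Submodule ℚ_[p] Ω :=
      (arborealFieldInfty Ω (X ^ p - C c) a).toSubalgebra.toSubmodule.restrictScalars ℚ_[p]
    have hV : FiniteDimensional ℚ_[p] V := hfd'
    obtain ⟨N, hNF⟩ := exists_card_le_of_separated V ‖b‖
    obtain ⟨F, hFc, hF, hsep⟩ := exists_finset_separated (c := algebraMap K Ω c)
      (a := algebraMap K Ω a) hζ (fun n z hz => by rw [(hT ha n z hz).2, hqb]) N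
    have := hNF F (fun z hz => ⟨mem_arborealFieldInfty (hF z hz), (hT ha _ z (hF z hz)).2.le⟩) hsep
    rw [hFc] at this
    exact absurd N.lt_two_pow_self (not_lt.2 this)
  · by_contra! ha
    obtain ⟨M, hM, hnorm⟩ := h.exists_normsInRootsOfPrime hN
    exact hfar ha M hM hnorm
  · have hfd : FiniteDimensional K (IntermediateField.adjoin K {b}) :=
      IntermediateField.adjoin.finiteDimensional (Algebra.IsIntegral.isIntegral b)
    have hfd' : FiniteDimensional ℚ_[p] (IntermediateField.adjoin K {b}) :=
      FiniteDimensional.trans ℚ_[p] K _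
    obtain ⟨L, hL, hLT⟩ := exists_intermediateField_normsInRootsOfPrime hζ hσ hb
      (fun n z hz => ⟨(hT ha n z hz).1, by rw [(hT ha n z hz).2, hqb]⟩)
      (IntermediateField.algebraMap_mem _ a) (IntermediateField.mem_adjoin_simple_self K b)
      (normsInRootsOfPrime_finrank hN (IntermediateField.adjoin K {b}))
    exact finitelyRamified_of_normsInRootsOfPrime hN Module.finrank_pos
      fun x hx hx0 => hL x (arborealFieldInfty_le hLT hx) hx0

end Main

/-- The theorem for an algebraic closure that already carries the spectral norm as its norm. -/
theorem mainTheorem1_of_normedField (p : ℕ) [hpp : Fact p.Prime]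
    {K : Type*} [Field K] [Algebra ℚ_[p] K] [FiniteDimensional ℚ_[p] K]
    {Ω : Type*} [NormedField Ω] [IsUltrametricDist Ω] [Algebra ℚ_[p] Ω]
    [IsAlgClosure ℚ_[p] Ω] [Algebra K Ω] [IsScalarTower ℚ_[p] K Ω]
    (hN : ∀ x : Ω, ‖x‖ = spectralNorm ℚ_[p] Ω x)
    (a c : K) (hc : c ≠ 0) (f : Polynomial K)
    (hf : f = Polynomial.X ^ p - Polynomial.C c) :
    (val p (algebraMap K Ω c) < ((-(p : ℝ) / ((p : ℝ) - 1) : ℝ) : WithTop ℝ) →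
      FiniteDimensional K (arborealFieldInfty Ω f a)) ∧
    (val p (algebraMap K Ω c) = ((-(p : ℝ) / ((p : ℝ) - 1) : ℝ) : WithTop ℝ) →
      ¬ FiniteDimensional K (arborealFieldInfty Ω f a) ∧
      (FinitelyRamified p (arborealFieldInfty Ω f a) ↔
        ∃ b : Ω, Polynomial.aeval b f = b ∧
          0 ≤ val p (algebraMap K Ω a - b)) ∧
      (FinitelyRamified p (arborealFieldInfty Ω f a) ↔
        ∀ b : Ω, Polynomial.aeval b f = b →
          0 ≤ val p (algebraMap K Ω a - b))) ∧
    (((-(p : ℝ) / ((p : ℝ) - 1) : ℝ) : WithTop ℝ) < val p (algebraMap K Ω c) →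
      ¬ FinitelyRamified p (arborealFieldInfty Ω f a)) := by
  subst hf
  have : IsAlgClosed Ω := IsAlgClosure.isAlgClosed ℚ_[p]
  have : Algebra.IsAlgebraic K Ω := Algebra.IsAlgebraic.tower_top (K := ℚ_[p]) K
  have : CharZero K := charZero_of_injective_algebraMap (algebraMap ℚ_[p] K).injective
  have : CharZero Ω := charZero_of_injective_algebraMap (algebraMap ℚ_[p] Ω).injective
  have : IsAlgClosure K Ω := ⟨inferInstance, inferInstance⟩
  have : IsGalois K Ω := IsAlgClosure.isGalois K Ω
  have : NeZero (p : Ω) := ⟨by exact_mod_cast hpp.out.ne_zero⟩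
  obtain ⟨ζ, hζ⟩ := HasEnoughRootsOfUnity.exists_primitiveRoot Ω p
  have hp : ‖(p : Ω)‖ = (p : ℝ)⁻¹ := by
    rw [hN, ← map_natCast (algebraMap ℚ_[p] Ω), spectralNorm_extends, Padic.norm_p]
  have hσ : ∀ (σ : Ω ≃ₐ[K] Ω) (x : Ω), ‖σ x‖ = ‖x‖ := fun σ x => by
    rw [hN, hN]
    exact (spectralNorm_eq_of_equiv (σ.restrictScalars ℚ_[p]) x).symm
  have hq := norm_one_sub_pos hζ
  have hqp := (norm_one_sub_pow_pred hζ).trans hp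
  have hc' : algebraMap K Ω c ≠ 0 := by simpa using hc
  have hfix : ∀ b : Ω, aeval b (X ^ p - C c : Polynomial K) = b ↔ b ^ p = b + algebraMap K Ω c := by
    intro b
    simp [sub_eq_iff_eq_add]
  refine ⟨fun h => ?_, fun h => ?_, fun h => ?_⟩
  · exact finiteDimensional_arborealFieldInfty hζ hp hσ ((val_lt_iff hN hq hqp hc').1 h)
  · have h1 : ‖algebraMap K Ω c‖ * ‖1 - ζ‖ ^ p = 1 :=
      le_antisymm (not_lt.1 fun h2 => ((val_lt_iff hN hq hqp hc').2 h2).ne h)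
        (not_lt.1 fun h2 => ((lt_val_iff hN hq hqp hc').2 h2).ne' h)
    simp only [hfix, val_nonneg_iff hN]
    obtain ⟨b, hb⟩ := exists_fixedPoint (p := p) (algebraMap K Ω c)
    have key := fun (b : Ω) hb => not_finiteDimensional_and_finitelyRamified_iff (a := a)
      hN hζ hp hσ h1 (b := b) hb
    exact ⟨(key b hb).1, ⟨fun h2 => ⟨b, hb, (key b hb).2.1 h2⟩,
      fun ⟨d, hd, h2⟩ => (key d hd).2.2 h2⟩, fun h2 d hd => (key d hd).2.1 h2,
      fun h2 => (key b hb).2.2 (h2 b hb)⟩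
  · exact not_finitelyRamified_of_norm_mul_pow_lt_one hN hζ hp hc ((lt_val_iff hN hq hqp hc').1 h)

end LocalArboreal

theorem mainTheorem1 (p : ℕ) [Fact p.Prime]
    {K : Type*} [Field K] [Algebra ℚ_[p] K] [FiniteDimensional ℚ_[p] K]
    {Ω : Type*} [Field Ω] [Algebra ℚ_[p] Ω] [IsAlgClosure ℚ_[p] Ω]
    [Algebra K Ω] [IsScalarTower ℚ_[p] K Ω]
    (a c : K) (hc : c ≠ 0) (f : Polynomial K)
    (hf : f = Polynomial.X ^ p - Polynomial.C c) :
    (LocalArboreal.val p (algebraMap K Ω c) < ((-(p : ℝ) / ((p : ℝ) - 1) : ℝ) : WithTop ℝ) →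
      FiniteDimensional K (LocalArboreal.arborealFieldInfty Ω f a)) ∧
    (LocalArboreal.val p (algebraMap K Ω c) = ((-(p : ℝ) / ((p : ℝ) - 1) : ℝ) : WithTop ℝ) →
      ¬ FiniteDimensional K (LocalArboreal.arborealFieldInfty Ω f a) ∧
      (LocalArboreal.FinitelyRamified p (LocalArboreal.arborealFieldInfty Ω f a) ↔
        ∃ b : Ω, Polynomial.aeval b f = b ∧
          0 ≤ LocalArboreal.val p (algebraMap K Ω a - b)) ∧
      (LocalArboreal.FinitelyRamified p (LocalArboreal.arborealFieldInfty Ω f a) ↔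
        ∀ b : Ω, Polynomial.aeval b f = b →
          0 ≤ LocalArboreal.val p (algebraMap K Ω a - b))) ∧
    (((-(p : ℝ) / ((p : ℝ) - 1) : ℝ) : WithTop ℝ) < LocalArboreal.val p (algebraMap K Ω c) →
      ¬ LocalArboreal.FinitelyRamified p (LocalArboreal.arborealFieldInfty Ω f a)) := by
  let := spectralNorm.normedField ℚ_[p] Ω
  have : IsUltrametricDist Ω :=
    IsUltrametricDist.isUltrametricDist_of_isNonarchimedean_norm
      (isNonarchimedean_spectralNorm (K := ℚ_[p]) (L := Ω))
  exact LocalArboreal.mainTheorem1_of_normedField p (fun _ => rfl) a c hc f hf
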